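/- Consider a fully connected feedforward network with $L\ge 2$ layers (arbitrary widths, arbitrary given weights and biases, e.g. from offline training), $$\hat y = W_L\,\phi(a_{L-1}) + b_L,\qquad a_1 = W_1x+b_1,\quad a_i = W_i\,\phi(a_{i-1})+b_i\ (2\le i\le L-1),$$ with a locally Lipschitz activation function $\phi:\mathbb R\to\mathbb R$ acting componentwise. The hidden layers are kept fixed, and the input $x:[0,\infty)\to\mathbb R^n$ is $C^1$ in time with $\phi(a_{L-1}(t))\neq 0$ for all $t\ge 0$. Let the target $y':[0,\infty)\to\mathbb R^m$ be $C^2$ with $|\ddot y'_i(t)|\le D_y$ for all $t\ge 0$ and all components $i$. Put $e_1=\hat y-y'$ and $e_2=\hat z_2-\dot y'$. Let $\Gamma = W_L\,\frac{d}{dt}\phi(a_{L-1})$ (defined for almost every $t$), which is assumed to be known exactly, and let the last layer be adapted online by the laws $$\dot b_L=\tfrac12\bigl(-k_1|e_1|^{1/2}\operatorname{sign}(e_1)-\Gamma+\hat z_2\bigr),\qquad \dot W_L=\dot b_L\,\frac{\phi(a_{L-1})^T}{\|\phi(a_{L-1})\|_2^2},\qquad \dot{\hat z}_2=-k_2\operatorname{sign}(e_1),$$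 where $|\cdot|^{1/2}$ and $\operatorname{sign}$ act componentwise and solutions are understood in the sense of Filippov. Theorem. For every $D_y>0$ there are gains $k_1,k_2>0$ such that the update laws make $e_1=0$ (together with $e_2=0$) a robustly, globally, finite-time stable equilibrium. That is, with $k_1,k_2$ depending on $D_y$ only, for all networks, inputs and targets as above: 1. from every initial value of $(b_L,W_L,\hat z_2)$ there is a solution on $[0,\infty)$, and every solution on an interval $[0,\tau)$, $0<\tau<\infty$, extends to a solution on $[0,\infty)$; 2. if $e_1(t_0)=e_2(t_0)=0$ for some $t_0\ge0$, then $e_1(t)=e_2(t)=0$ for all $t\ge t_0$; 3. for every $\varepsilon>0$ there is $\delta>0$ such that $\|e_1(t_0)\|_\infty,\|e_2(t_0)\|_\infty<\delta$ implies $\|e_1(t)\|_\infty,\|e_2(t)\|_\infty<\varepsilon$ for all $t\ge t_0\ge 0$; 4. for every $R>0$ there is $T>0$ such that $\|e_1(t_0)\|_\infty,\|e_2(t_0)\|_\infty\le R$ with $t_0\ge0$ implies $e_1(t)=e_2(t)=0$ for all $t\ge t_0+T$. Robustness means that $\delta$ and $T$ depend only on $\varepsilon$, respectively $R$ (and on $D_y,k_1,k_2$),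 and not on the network, the input, the target, the starting time or the solution. -/

import Mathlib

open Set MeasureTheory

noncomputable section

/-- The hidden part (layers `1, …, L - 1`, where `L ≥ 2`) of a fully connected feedforward network
with input dimension `n`; the second index is the width of the last hidden layer. -/
inductive HiddenLayers (n : ℕ) : ℕ → Type
  | first {p : ℕ} (W : Matrix (Fin p) (Fin n) ℝ) (b : Fin p → ℝ) : HiddenLayers n p
  | next {q p : ℕ} (N : HiddenLayers n q) (W : Matrix (Fin p) (Fin q) ℝ) (b : Fin p → ℝ) :
      HiddenLayers n p

/-- The output `a_{L-1}` of the next-to-last layer: `a_1 = W_1 x + b_1` and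
`a_i = W_i φ(a_{i-1}) + b_i`, with `φ` acting componentwise. -/
def HiddenLayers.output {n : ℕ} (φ : ℝ → ℝ) :
    {p : ℕ} → HiddenLayers n p → (Fin n → ℝ) → Fin p → ℝ
  | _, .first W b, x => W.mulVec x + b
  | _, .next N W b, x => W.mulVec (fun j => φ (N.output φ x j)) + b

/-- The data of the online learning problem: the frozen hidden layers, the activation function `φ`,
the network input `x(t)` and the approximation target `y'(t)`. Only times `t ≥ 0` matter. -/
structure OnlineTask (n p m : ℕ) where
  hidden : HiddenLayers n p
  φ : ℝ → ℝ
  x : ℝ → Fin n → ℝ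
  target : ℝ → Fin m → ℝ

/-- The adapted quantities `(b_L, W_L, ẑ₂)`. -/
abbrev LastLayerState (p m : ℕ) : Type :=
  (Fin m → ℝ) × (Fin m → Fin p → ℝ) × (Fin m → ℝ)

/-- The Filippov regularisation of a vector field `f` on a finite-dimensional space:
`⋂_{δ > 0} ⋂_{N null} closed convex hull of f (ball x δ \ N)`. -/
def filippovMap {E : Type*} [NormedAddCommGroup E] [NormedSpace ℝ E] [MeasureSpace E]
    (f : E → E) (x : E) : Set E :=
  {v | ∀ δ : ℝ, 0 < δ → ∀ N : Set E, volume N = 0 →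
    v ∈ closure (convexHull ℝ (f '' (Metric.ball x δ \ N)))}

/-- `X` is a Filippov solution of `Ẋ = f(t, X)` on the interval `I`, which starts at time `0`
(`I = [0, τ)` or `I = [0, ∞)`): it is locally absolutely continuous on `I`, and for almost every
time its derivative exists and lies in the Filippov regularisation of `f(t, ·)` at `X(t)`. -/
def IsFilippovSolution {E : Type*} [NormedAddCommGroup E] [NormedSpace ℝ E] [MeasureSpace E]
    (f : ℝ → E → E) (I : Set ℝ) (X : ℝ → E) : Prop :=
  (∀ T ∈ I, AbsolutelyContinuousOnInterval X 0 T) ∧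
    ∀ᵐ t : ℝ, t ∈ I → ∃ v ∈ filippovMap (f t) (X t), HasDerivAt X v t

namespace OnlineTask

variable {n p m : ℕ}

/-- The input `φ(a_{L-1})` of the last layer, as a function of time. -/
def feature (S : OnlineTask n p m) (t : ℝ) (j : Fin p) : ℝ :=
  S.φ (S.hidden.output S.φ (S.x t) j)

/-- The standing assumptions: `φ` is locally Lipschitz (so that `φ(a_{L-1})` has a time derivative
almost everywhere), `x` is C¹, `y'` is C² with second derivative bounded by `D` in each
component, and the division by `‖φ(a_{L-1})‖²` in the update law is meaningful. -/
structure Admissible (S : OnlineTask n p m) (D : ℝ) : Prop where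
  locallyLipschitz_activation : LocallyLipschitz S.φ
  contDiffOn_input : ContDiffOn ℝ 1 S.x (Ici 0)
  contDiffOn_target : ContDiffOn ℝ 2 S.target (Ici 0)
  target_bound : ∀ t : ℝ, 0 ≤ t → ∀ i, |iteratedDerivWithin 2 S.target (Ici 0) t i| ≤ D
  feature_ne_zero : ∀ t : ℝ, 0 ≤ t → S.feature t ≠ 0

/-- The network output `ŷ = W_L φ(a_{L-1}) + b_L`. -/
def output (S : OnlineTask n p m) (t : ℝ) (X : LastLayerState p m) (i : Fin m) : ℝ :=
  ∑ j, X.2.1 i j * S.feature t j + X.1 i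

/-- The activation derivative term `Γ = W_L dφ(a_{L-1})/dt`. -/
def Gamma (S : OnlineTask n p m) (t : ℝ) (X : LastLayerState p m) (i : Fin m) : ℝ :=
  ∑ j, X.2.1 i j * deriv (fun s => S.feature s j) t

/-- The prediction error `e₁ = ŷ - y'`. -/
def e₁ (S : OnlineTask n p m) (t : ℝ) (X : LastLayerState p m) (i : Fin m) : ℝ :=
  S.output t X i - S.target t i

/-- The second error variable `e₂ = ẑ₂ - z'₂`, where `z'₂` is the time derivative of `y'`. -/
def e₂ (S : OnlineTask n p m) (t : ℝ) (X : LastLayerState p m) (i : Fin m) : ℝ :=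
  X.2.2 i - derivWithin S.target (Ici 0) t i

/-- Update law for `b_L`; `|·|^{1/2}` and `sign` act componentwise. -/
def biasLaw (S : OnlineTask n p m) (k₁ : ℝ) (t : ℝ) (X : LastLayerState p m) (i : Fin m) : ℝ :=
  (1 / 2) * (-k₁ * √|S.e₁ t X i| * Real.sign (S.e₁ t X i) - S.Gamma t X i + X.2.2 i)

/-- Update law for `W_L`: `ḃ_L φᵀ / ‖φ‖₂²`. -/
def weightLaw (S : OnlineTask n p m) (k₁ : ℝ) (t : ℝ) (X : LastLayerState p m)
    (i : Fin m) (j : Fin p) : ℝ :=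
  S.biasLaw k₁ t X i * (S.feature t j / ∑ l, S.feature t l ^ 2)

/-- The closed-loop vector field for `(b_L, W_L, ẑ₂)`. -/
def updateField (S : OnlineTask n p m) (k₁ k₂ : ℝ) (t : ℝ) (X : LastLayerState p m) :
    LastLayerState p m :=
  (S.biasLaw k₁ t X, S.weightLaw k₁ t X, fun i => -k₂ * Real.sign (S.e₁ t X i))

/-- `X = (b_L, W_L, ẑ₂)` follows the update laws on `I`, in the sense of Filippov. -/
def FollowsUpdateLaws (S : OnlineTask n p m) (k₁ k₂ : ℝ) (I : Set ℝ)
    (X : ℝ → LastLayerState p m) : Prop :=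
  IsFilippovSolution (S.updateField k₁ k₂) I X

end OnlineTask

/-- Forward completeness of the adaptation for all admissible data: there is a solution
on `[0, ∞)` from every initial state, and no solution stops or escapes in finite time. -/
def ForwardComplete (D k₁ k₂ : ℝ) : Prop :=
  ∀ (n p m : ℕ) (S : OnlineTask n p m), S.Admissible D →
    (∀ X₀ : LastLayerState p m, ∃ X, X 0 = X₀ ∧ S.FollowsUpdateLaws k₁ k₂ (Ici 0) X) ∧
    ∀ (τ : ℝ) (X : ℝ → LastLayerState p m), 0 < τ → S.FollowsUpdateLaws k₁ k₂ (Ico 0 τ) X →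
      ∃ X', S.FollowsUpdateLaws k₁ k₂ (Ici 0) X' ∧ EqOn X' X (Ico 0 τ)

/-- Once the errors `e₁`, `e₂` vanish they stay zero. -/
def ErrorEquilibrium (D k₁ k₂ : ℝ) : Prop :=
  ∀ (n p m : ℕ) (S : OnlineTask n p m), S.Admissible D →
    ∀ X, S.FollowsUpdateLaws k₁ k₂ (Ici 0) X →
      ∀ t₀ : ℝ, 0 ≤ t₀ → S.e₁ t₀ (X t₀) = 0 → S.e₂ t₀ (X t₀) = 0 →
        ∀ t : ℝ, t₀ ≤ t → S.e₁ t (X t) = 0 ∧ S.e₂ t (X t) = 0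

/-- Lyapunov stability of the zero error, robustly: `δ` depends on `ε` only, not on the network,
the input, the target, or the starting time. Norms are maximum norms. -/
def RobustlyStable (D k₁ k₂ : ℝ) : Prop :=
  ∀ ε : ℝ, 0 < ε → ∃ δ : ℝ, 0 < δ ∧
    ∀ (n p m : ℕ) (S : OnlineTask n p m), S.Admissible D →
      ∀ X, S.FollowsUpdateLaws k₁ k₂ (Ici 0) X →
        ∀ t₀ : ℝ, 0 ≤ t₀ → ‖S.e₁ t₀ (X t₀)‖ < δ → ‖S.e₂ t₀ (X t₀)‖ < δ →
          ∀ t : ℝ, t₀ ≤ t → ‖S.e₁ t (X t)‖ < ε ∧ ‖S.e₂ t (X t)‖ < ε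

/-- Global finite-time convergence of the error to zero, robustly: the settling time is bounded
in terms of the size of the initial errors only. -/
def RobustlyFiniteTimeConvergent (D k₁ k₂ : ℝ) : Prop :=
  ∀ R : ℝ, 0 < R → ∃ T : ℝ, 0 < T ∧
    ∀ (n p m : ℕ) (S : OnlineTask n p m), S.Admissible D →
      ∀ X, S.FollowsUpdateLaws k₁ k₂ (Ici 0) X →
        ∀ t₀ : ℝ, 0 ≤ t₀ → ‖S.e₁ t₀ (X t₀)‖ ≤ R → ‖S.e₂ t₀ (X t₀)‖ ≤ R →
          ∀ t : ℝ, t₀ + T ≤ t → S.e₁ t (X t) = 0 ∧ S.e₂ t (X t) = 0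

end

open Filter Topology
open scoped NNReal

/-! The network drops out of the error dynamics. Write φ for the last-layer input. Since φᵀφ/‖φ‖² =
1, the weight law contributes Ẇφ = ḃ, so the factor 1/2 in the bias law is compensated and its Γ
cancels Wφ̇ from the product rule. For each component, (x, y) = (e₁, e₂) then satisfies ẋ =
-k₁|x|^{1/2} sign x + y and ẏ ∈ -k₂ Sign x - ÿ', with |ÿ'| ≤ D. This is the super-twisting inclusion
(`hasDerivAt_e₁`, `hasDerivAt_e₂`, `isSuperTwistingTrajectory`).

Put D = d², k₁ = 4d, k₂ = 2d². The function V = 16d³|x|^{3/2} - 6d²xy + |y|³/3 is C¹ and homogeneous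
of degree 3 for the weights (2, 1). It is positive definite, V ≤ N^{3/2} with N = 16d²|x| + y², and
V̇ ≤ -(d²/4)N for every admissible velocity (`superTwistingLyapunov_decrease`). Monotonicity of V
gives the equilibrium property and stability. As long as V > 0, the derivative of V^{1/3} is at most
-d²/12, so V vanishes after a time controlled by its initial value (`lyapunov_rpow_le`). All
constants involve d alone, hence the robustness.

The Filippov regularisation is computed exactly (`IsUpdateVelocity`): the (b, W) components of the
field are continuous in the state, and the ẑ₂ components fill a box, because shifting b realises
every sign pattern of e₁ independently. Existence is by limits of delay equations
(`exists_delay_limit`). Where a component of e₁ is nonzero its sign passes to the limit. Where it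
vanishes, the Lipschitz bound k₂ on that component of ẑ₂ is all the inclusion demands. Linear growth
in the state excludes blow-up, so every solution can be continued. -/

/-! ### Absolutely continuous and Lipschitz curves. -/

theorem LipschitzWith.comp_absolutelyContinuousOnInterval {E F : Type*} [PseudoMetricSpace E]
    [PseudoMetricSpace F] {g : E → F} {K : ℝ≥0} (hg : LipschitzWith K g) {f : ℝ → E} {a b : ℝ}
    (hf : AbsolutelyContinuousOnInterval f a b) :
    AbsolutelyContinuousOnInterval (fun t => g (f t)) a b := by
  unfold AbsolutelyContinuousOnInterval at hf ⊢
  refine squeeze_zero (fun E => Finset.sum_nonneg fun i _ => dist_nonneg) (fun E => ?_)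
    (by simpa using hf.const_mul (K : ℝ))
  rw [Finset.mul_sum]
  exact Finset.sum_le_sum fun i _ => hg.dist_le_mul _ _

theorem AbsolutelyContinuousOnInterval.sub_le_of_deriv_le {f : ℝ → ℝ} {a b C : ℝ} (hab : a ≤ b)
    (hf : AbsolutelyContinuousOnInterval f a b)
    (h : ∀ᵐ t : ℝ, t ∈ Ioo a b → ∃ v ≤ C, HasDerivAt f v t) :
    f b - f a ≤ C * (b - a) := by
  rw [← hf.integral_deriv_eq_sub]
  have h2 : ∫ t in a..b, deriv f t ≤ ∫ _ in a..b, C := by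
    refine intervalIntegral.integral_mono_ae_restrict hab hf.intervalIntegrable_deriv
      intervalIntegrable_const ?_
    rw [← Measure.restrict_congr_set Ioo_ae_eq_Icc, EventuallyLE,
      ae_restrict_iff' measurableSet_Ioo]
    filter_upwards [h] with t ht hmem
    obtain ⟨v, hv, hd⟩ := ht hmem
    rw [hd.deriv]
    exact hv
  simpa [mul_comm] using h2

/-- A functional of norm at most one that norms `f b - f a` (Hahn–Banach) reduces the estimate to
the scalar case. -/
theorem AbsolutelyContinuousOnInterval.norm_sub_le_of_norm_deriv_le {E : Type*}
    [NormedAddCommGroup E] [NormedSpace ℝ E] {f : ℝ → E} {a b C : ℝ} (hab : a ≤ b)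
    (hf : AbsolutelyContinuousOnInterval f a b)
    (h : ∀ᵐ t : ℝ, t ∈ Ioo a b → ∃ v, ‖v‖ ≤ C ∧ HasDerivAt f v t) :
    ‖f b - f a‖ ≤ C * (b - a) := by
  obtain ⟨ℓ, hℓ, hval⟩ := exists_dual_vector'' ℝ (f b - f a)
  have hac := ℓ.lipschitz.comp_absolutelyContinuousOnInterval hf
  have := hac.sub_le_of_deriv_le (C := C) hab (by
    filter_upwards [h] with t ht hmem
    obtain ⟨v, hv, hd⟩ := ht hmem
    refine ⟨ℓ v, ?_, ℓ.hasFDerivAt.comp_hasDerivAt t hd⟩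
    calc ℓ v ≤ ‖ℓ v‖ := le_abs_self _
      _ ≤ ‖ℓ‖ * ‖v‖ := ℓ.le_opNorm v
      _ ≤ 1 * ‖v‖ := by gcongr
      _ ≤ C := by simpa using hv)
  rw [← map_sub] at this
  simpa [hval] using this

theorem lipschitzOnWith_of_absolutelyContinuous {E : Type*}
    [NormedAddCommGroup E] [NormedSpace ℝ E] {f : ℝ → E} {s : Set ℝ} (hs : s.OrdConnected) {C : ℝ≥0}
    (hf : ∀ a ∈ s, ∀ b ∈ s, a ≤ b → AbsolutelyContinuousOnInterval f a b)
    (h : ∀ᵐ t : ℝ, t ∈ interior s → ∃ v, ‖v‖ ≤ C ∧ HasDerivAt f v t) :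
    LipschitzOnWith C f s := by
  have key : ∀ a ∈ s, ∀ b ∈ s, a ≤ b → dist (f a) (f b) ≤ C * dist a b := by
    intro a ha b hb hab
    rw [dist_comm, dist_eq_norm, dist_comm, Real.dist_eq, abs_of_nonneg (sub_nonneg.2 hab)]
    refine (hf a ha b hb hab).norm_sub_le_of_norm_deriv_le hab ?_
    filter_upwards [h] with t ht hmem
    exact ht (interior_maximal (Ioo_subset_Icc_self.trans (hs.out ha hb)) isOpen_Ioo hmem)
  refine LipschitzOnWith.of_dist_le_mul fun a ha b hb => ?_
  rcases le_total a b with hab | hab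
  · exact key a ha b hb hab
  · rw [dist_comm, dist_comm a]
    exact key b hb a ha hab

theorem LocallyLipschitz.pi {α : Type*} [PseudoMetricSpace α] {p : ℕ} {f : α → Fin p → ℝ}
    (hf : ∀ j, LocallyLipschitz fun x => f x j) : LocallyLipschitz f := by
  intro x
  choose K t ht hK using fun j => hf j x
  refine ⟨Finset.univ.sup K, ⋂ j, t j, (Filter.iInter_mem).2 ht, ?_⟩
  refine LipschitzOnWith.of_dist_le_mul fun a ha b hb => ?_
  refine (dist_pi_le_iff (by positivity)).2 fun j => ?_
  refine ((hK j).dist_le_mul a (mem_iInter.1 ha j) b (mem_iInter.1 hb j)).trans ?_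
  gcongr
  exact Finset.le_sup (f := K) (Finset.mem_univ j)

theorem LipschitzOnWith.norm_deriv_le {E : Type*} [NormedAddCommGroup E] [NormedSpace ℝ E]
    {f : ℝ → E} {K : ℝ≥0} {s : Set ℝ} (hf : LipschitzOnWith K f s) {t : ℝ} (ht : s ∈ 𝓝 t) :
    ‖deriv f t‖ ≤ K :=
  norm_deriv_le_of_lipschitzOn ht hf

/-! ### The super-twisting Lyapunov function and its decrease. -/

/-- The exponent 3/2 exceeds 1, so the formula persists at 0. This makes the Lyapunov function C¹
across x = 0, and the chain rule needs no exceptional times there. -/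
theorem hasDerivAt_abs_mul_abs_sqrt (x : ℝ) :
    HasDerivAt (fun x : ℝ => |x| * √|x|) (3 / 2 * (√|x| * Real.sign x)) x := by
  have h := hasDerivAt_abs_rpow x (p := 3 / 2) (by norm_num)
  have e : (fun x : ℝ => |x| * √|x|) = fun x : ℝ => |x| ^ (3 / 2 : ℝ) := by
    funext z
    rw [Real.sqrt_eq_rpow]
    rcases eq_or_ne z 0 with rfl | hz
    · norm_num
    · rw [show (3 / 2 : ℝ) = 1 + 1 / 2 by norm_num, Real.rpow_add (abs_pos.2 hz), Real.rpow_one]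
  rw [e]
  convert h using 1
  rw [Real.sqrt_eq_rpow, mul_assoc]
  congr 1
  rcases lt_trichotomy x 0 with hx | rfl | hx
  · rw [Real.sign_of_neg hx, show (1 / 2 : ℝ) = 3 / 2 - 2 + 1 by norm_num,
      Real.rpow_add (abs_pos.2 hx.ne), Real.rpow_one, abs_of_neg hx]
    ring
  · simp
  · rw [Real.sign_of_pos hx, show (1 / 2 : ℝ) = 3 / 2 - 2 + 1 by norm_num,
      Real.rpow_add (abs_pos.2 hx.ne'), Real.rpow_one, abs_of_pos hx]
    ring

theorem hasDerivAt_abs_pow_three (y : ℝ) : HasDerivAt (fun y : ℝ => |y| ^ 3) (3 * (|y| * y)) y := by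
  have h := hasDerivAt_abs_rpow y (p := 3) (by norm_num)
  have e : (fun y : ℝ => |y| ^ 3) = fun y : ℝ => |y| ^ (3 : ℝ) := by
    funext z
    exact_mod_cast (Real.rpow_natCast |z| 3).symm
  rw [e]
  convert h using 1
  norm_num [mul_assoc]

/-- A homogeneous `C¹` strict Lyapunov function of the super-twisting system
with gains `k₁ = 4 d`, `k₂ = 2 d²` and perturbations bounded by `d²`. -/
noncomputable def superTwistingLyapunov (d x y : ℝ) : ℝ :=
  16 * d ^ 3 * (|x| * √|x|) - 6 * d ^ 2 * (x * y) + |y| ^ 3 / 3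

theorem continuous_superTwistingLyapunov (d : ℝ) :
    Continuous fun z : ℝ × ℝ => superTwistingLyapunov d z.1 z.2 := by
  unfold superTwistingLyapunov
  fun_prop

theorem superTwistingLyapunov_zero (d : ℝ) : superTwistingLyapunov d 0 0 = 0 := by
  simp [superTwistingLyapunov]

theorem abs_eq_sq_sqrt_abs (x : ℝ) : |x| = √|x| ^ 2 := (Real.sq_sqrt (abs_nonneg x)).symm

/-- With a = 4d√|x| and b = |y|, replacing xy by |x||y| in the Lyapunov function leaves exactly 1/24
of this form above (a³ + b³)/24. -/
theorem cubic_form_lower {a b : ℝ} (ha : 0 ≤ a) (hb : 0 ≤ b) :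
    0 ≤ 5 * a ^ 3 - 9 * a ^ 2 * b + 7 * b ^ 3 := by
  nlinarith [mul_nonneg ha (sq_nonneg (2 * a - 3 * b)), pow_nonneg ha 3, pow_nonneg hb 3,
    mul_nonneg hb (sq_nonneg (2 * a - 3 * b))]

theorem le_superTwistingLyapunov {d : ℝ} (hd : 0 < d) (x y : ℝ) :
    (64 * d ^ 3 * (|x| * √|x|) + |y| ^ 3) / 24 ≤ superTwistingLyapunov d x y := by
  unfold superTwistingLyapunov
  have hxy : x * y ≤ |x| * |y| := by rw [← abs_mul]; exact le_abs_self _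
  have hx := abs_eq_sq_sqrt_abs x
  set s := √|x| with hs
  have hs0 : 0 ≤ s := Real.sqrt_nonneg _
  have hy0 := abs_nonneg y
  have := cubic_form_lower (a := 4 * d * s) (b := |y|) (by positivity) hy0
  have h2 : 6 * d ^ 2 * (x * y) ≤ 6 * d ^ 2 * (|x| * |y|) := by gcongr
  rw [hx] at h2 ⊢
  nlinarith

theorem superTwistingLyapunov_nonneg {d : ℝ} (hd : 0 < d) (x y : ℝ) :
    0 ≤ superTwistingLyapunov d x y :=
  le_trans (by positivity) (le_superTwistingLyapunov hd x y)

/-- Both 4d√|x| and |y| are at most the root on the right, and in these variables the coefficients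
1/4, 3/8, 1/3 add up to 23/24. -/
theorem superTwistingLyapunov_le {d : ℝ} (hd : 0 < d) (x y : ℝ) :
    superTwistingLyapunov d x y ≤ √(16 * d ^ 2 * |x| + y ^ 2) ^ 3 := by
  unfold superTwistingLyapunov
  have hxy : -(x * y) ≤ |x| * |y| := by rw [← abs_mul]; exact neg_le_abs _
  have hx := abs_eq_sq_sqrt_abs x
  set s := √|x| with hs
  have hs0 : 0 ≤ s := Real.sqrt_nonneg _
  have hy0 := abs_nonneg y
  set r := √(16 * d ^ 2 * |x| + y ^ 2) with hr
  have h2 : 6 * d ^ 2 * (-(x * y)) ≤ 6 * d ^ 2 * (|x| * |y|) := by gcongr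
  have hr0 : 0 ≤ r := Real.sqrt_nonneg _
  have h3 : 4 * d * s ≤ r := Real.le_sqrt_of_sq_le (by rw [hx]; nlinarith [sq_nonneg y])
  have h4 : |y| ≤ r := Real.le_sqrt_of_sq_le (by
    rw [sq_abs]
    linarith [mul_nonneg (sq_nonneg d) (abs_nonneg x)])
  have h5 : (4 * d * s) ^ 3 ≤ r ^ 3 := by gcongr
  have h6 : (4 * d * s) ^ 2 * |y| ≤ r ^ 2 * r := by gcongr
  have h7 : |y| ^ 3 ≤ r ^ 3 := by gcongr
  rw [hx] at h2 ⊢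
  nlinarith [pow_nonneg hr0 3]

theorem hasDerivAt_superTwistingLyapunov (d : ℝ) {x y : ℝ → ℝ} {x' y' t : ℝ}
    (hx : HasDerivAt x x' t) (hy : HasDerivAt y y' t) :
    HasDerivAt (fun t => superTwistingLyapunov d (x t) (y t))
      ((24 * d ^ 3 * (√|x t| * Real.sign (x t)) - 6 * d ^ 2 * y t) * x' +
        (|y t| * y t - 6 * d ^ 2 * x t) * y') t := by
  unfold superTwistingLyapunov
  have h1 := (hasDerivAt_abs_mul_abs_sqrt (x t)).comp t hx
  have h2 := (hasDerivAt_abs_pow_three (y t)).comp t hy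
  have h3 := ((h1.const_mul (16 * d ^ 3)).sub ((hx.mul hy).const_mul (6 * d ^ 2))).add
    (h2.div_const 3)
  refine h3.congr_deriv ?_
  ring

/-- The right-hand side of the super-twisting inclusion with gains `4 d`, `2 d²`. -/
structure IsSuperTwistingVelocity (d x y x' y' : ℝ) : Prop where
  fst : x' = -(4 * d) * √|x| * Real.sign x + y
  snd_pos : 0 < x → y' ∈ Icc (-(3 * d ^ 2)) (-d ^ 2)
  snd_neg : x < 0 → y' ∈ Icc (d ^ 2) (3 * d ^ 2)
  snd_le : |y'| ≤ 3 * d ^ 2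

/-- The half-plane x > 0, with s = √x. Scaling by σ = 4ds and w = -d²u removes d and leaves an
expression affine in u ∈ [1, 3]. For y ≥ 0 it is a negative definite quadratic form at both ends u =
1 and u = 3. For y ≤ 0 the term -6(σ - y)² ≤ -6(σ² + y²) dominates. -/
theorem quadratic_form_decrease {d s y w : ℝ} (hd : 0 < d) (hs : 0 < s)
    (hw : w ∈ Icc (-(3 * d ^ 2)) (-d ^ 2)) :
    (24 * d ^ 3 * s - 6 * d ^ 2 * y) * (-(4 * d) * s + y) + (|y| * y - 6 * d ^ 2 * s ^ 2) * w ≤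
      -(d ^ 2 / 4) * (16 * d ^ 2 * s ^ 2 + y ^ 2) := by
  obtain ⟨u, rfl⟩ : ∃ u, w = -(d ^ 2 * u) := ⟨-w / d ^ 2, by field_simp⟩
  have hd2 : 0 < d ^ 2 := by positivity
  have hu1 : 1 ≤ u := by nlinarith [hw.2]
  have hu3 : u ≤ 3 := by nlinarith [hw.1]
  obtain ⟨σ, hσ⟩ : ∃ σ, σ = 4 * d * s := ⟨_, rfl⟩
  have hσ0 : 0 < σ := by rw [hσ]; positivity
  suffices h : (6 * σ - 6 * y) * (-σ + y) - (|y| * y - 3 / 8 * σ ^ 2) * u +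
      (σ ^ 2 + y ^ 2) / 4 ≤ 0 by
    have := mul_nonpos_of_nonneg_of_nonpos hd2.le h
    rw [hσ] at this
    linarith
  rcases le_total 0 y with hy | hy
  · rw [abs_of_nonneg hy]
    nlinarith [mul_nonneg (sub_nonneg.2 hu3) (sq_nonneg (σ - 27 / 25 * y)),
      mul_nonneg (sub_nonneg.2 hu1) (sq_nonneg (σ - 6 / 5 * y)), sq_nonneg (σ - 27 / 25 * y),
      sq_nonneg (σ - 6 / 5 * y), mul_nonneg (sub_nonneg.2 hu1) (sq_nonneg y)]
  · rw [abs_of_nonpos hy]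
    nlinarith [mul_nonneg hσ0.le (neg_nonneg.2 hy), mul_nonneg (sub_nonneg.2 hu3) (sq_nonneg y),
      mul_nonneg (sub_nonneg.2 hu3) (sq_nonneg σ), sq_nonneg σ, sq_nonneg y]

theorem superTwistingLyapunov_decrease {d x y x' y' : ℝ} (hd : 0 < d)
    (h : IsSuperTwistingVelocity d x y x' y') :
    (24 * d ^ 3 * (√|x| * Real.sign x) - 6 * d ^ 2 * y) * x' + (|y| * y - 6 * d ^ 2 * x) * y' ≤
      -(d ^ 2 / 4) * (16 * d ^ 2 * |x| + y ^ 2) := by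
  rw [h.fst]
  have hx := abs_eq_sq_sqrt_abs x
  rcases lt_trichotomy x 0 with hx0 | rfl | hx0
  · have hw := h.snd_neg hx0
    have := quadratic_form_decrease (s := √|x|) (y := -y) (w := -y') hd
      (Real.sqrt_pos.2 (abs_pos.2 hx0.ne)) ⟨by linarith [hw.2], by linarith [hw.1]⟩
    rw [abs_neg, ← hx] at this
    rw [Real.sign_of_neg hx0]
    have hxx : x = -|x| := by rw [abs_of_neg hx0]; ring
    have e : (|y| * y - 6 * d ^ 2 * x) * y' = (|y| * y + 6 * d ^ 2 * |x|) * y' := by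
      rw [abs_of_neg hx0]; ring
    rw [e]
    nlinarith
  -- On x = 0 the first product is -6d²y², and |y'| ≤ 3d² lets the second recover only half of it.
  · have hw := h.snd_le
    simp only [abs_zero, Real.sqrt_zero, Real.sign_zero]
    have h1 : |y| * y * y' ≤ y ^ 2 * (3 * d ^ 2) := by
      calc |y| * y * y' ≤ |(|y| * y * y')| := le_abs_self _
        _ = y ^ 2 * |y'| := by rw [abs_mul, abs_mul, abs_abs, abs_mul_abs_self]; ring
        _ ≤ _ := by gcongr
    nlinarith [mul_nonneg (sq_nonneg d) (sq_nonneg y)]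
  · have := quadratic_form_decrease (s := √|x|) (y := y) (w := y') hd
      (Real.sqrt_pos.2 (abs_pos.2 hx0.ne')) (h.snd_pos hx0)
    rw [← hx] at this
    rw [Real.sign_of_pos hx0, ← abs_of_pos hx0, abs_abs]
    linarith

/-! ### Decay of the Lyapunov function along trajectories. -/

/-- A trajectory of the super-twisting inclusion on `[0, ∞)`. -/
structure IsSuperTwistingTrajectory (d : ℝ) (x y : ℝ → ℝ) : Prop where
  lipschitz_fst : ∀ T, ∃ K : ℝ≥0, LipschitzOnWith K x (Icc 0 T)
  lipschitz_snd : ∀ T, ∃ K : ℝ≥0, LipschitzOnWith K y (Icc 0 T)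
  ae_velocity : ∀ᵐ t : ℝ, 0 < t → ∃ x' y', HasDerivAt x x' t ∧ HasDerivAt y y' t ∧
    IsSuperTwistingVelocity d (x t) (y t) x' y'

theorem contDiff_one_of_hasDerivAt {f f' : ℝ → ℝ} (h : ∀ x, HasDerivAt f (f' x) x)
    (hf' : Continuous f') : ContDiff ℝ 1 f := by
  rw [contDiff_one_iff_deriv]
  exact ⟨fun x => (h x).differentiableAt, by rwa [funext fun x => (h x).deriv]⟩

theorem continuous_sqrt_abs_mul_sign : Continuous fun x : ℝ => √|x| * Real.sign x := by
  have e : (fun x : ℝ => √|x| * Real.sign x) = fun x : ℝ => √x - √(-x) := by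
    funext x
    rcases lt_trichotomy x 0 with hx | rfl | hx
    · rw [Real.sign_of_neg hx, abs_of_neg hx, Real.sqrt_eq_zero_of_nonpos hx.le]; ring
    · simp
    · rw [Real.sign_of_pos hx, abs_of_pos hx, Real.sqrt_eq_zero_of_nonpos (x := -x) (by linarith)]
      ring
  rw [e]
  fun_prop

theorem contDiff_superTwistingLyapunov (d : ℝ) :
    ContDiff ℝ 1 fun z : ℝ × ℝ => superTwistingLyapunov d z.1 z.2 := by
  have h1 : ContDiff ℝ 1 fun x : ℝ => |x| * √|x| :=
    contDiff_one_of_hasDerivAt hasDerivAt_abs_mul_abs_sqrt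
      (continuous_const.mul continuous_sqrt_abs_mul_sign)
  have h2 : ContDiff ℝ 1 fun y : ℝ => |y| ^ 3 :=
    contDiff_one_of_hasDerivAt hasDerivAt_abs_pow_three (by fun_prop)
  unfold superTwistingLyapunov
  exact ((contDiff_const.mul (h1.comp contDiff_fst)).sub
    (contDiff_const.mul (contDiff_fst.mul contDiff_snd))).add
    ((h2.comp contDiff_snd).div_const 3)

theorem ContDiffOn.comp_lipschitzOnWith {E : Type*} [NormedAddCommGroup E] [NormedSpace ℝ E]
    [FiniteDimensional ℝ E] {F : Type*} [NormedAddCommGroup F] [NormedSpace ℝ F] {g : E → F}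
    {u : Set E} (hu : Convex ℝ u) (hg : ContDiffOn ℝ 1 g u) {f : ℝ → E} {a b : ℝ} {K : ℝ≥0}
    (hf : LipschitzOnWith K f (Icc a b)) (hmaps : MapsTo f (Icc a b) u) :
    ∃ K' : ℝ≥0, LipschitzOnWith K' (fun t => g (f t)) (Icc a b) := by
  obtain ⟨C, hC⟩ :=
      (hg.locallyLipschitzOn hu |>.mono hmaps.image_subset).exists_lipschitzOnWith_of_compact
    (isCompact_Icc.image_of_continuousOn hf.continuousOn)
  exact ⟨C * K, hC.comp hf (mapsTo_image f _)⟩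

namespace IsSuperTwistingTrajectory

variable {d : ℝ} {x y : ℝ → ℝ}

theorem lipschitz_lyapunov (h : IsSuperTwistingTrajectory d x y) (T : ℝ) :
    ∃ K : ℝ≥0, LipschitzOnWith K (fun t => superTwistingLyapunov d (x t) (y t)) (Icc 0 T) := by
  obtain ⟨K₁, h₁⟩ := h.lipschitz_fst T
  obtain ⟨K₂, h₂⟩ := h.lipschitz_snd T
  exact ContDiffOn.comp_lipschitzOnWith (u := univ) convex_univ
    (contDiff_superTwistingLyapunov d).contDiffOn (h₁.prodMk h₂) (mapsTo_univ _ _)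

theorem ae_lyapunov_deriv (hd : 0 < d) (h : IsSuperTwistingTrajectory d x y) :
    ∀ᵐ t : ℝ, 0 < t → ∃ v, HasDerivAt (fun t => superTwistingLyapunov d (x t) (y t)) v t ∧
      v ≤ -(d ^ 2 / 4) * (16 * d ^ 2 * |x t| + y t ^ 2) := by
  filter_upwards [h.ae_velocity] with t ht h0
  obtain ⟨x', y', hx, hy, hv⟩ := ht h0
  exact ⟨_, hasDerivAt_superTwistingLyapunov d hx hy, superTwistingLyapunov_decrease hd hv⟩

theorem lyapunov_antitone (hd : 0 < d) (h : IsSuperTwistingTrajectory d x y) {a b : ℝ} (ha : 0 ≤ a)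
    (hab : a ≤ b) :
    superTwistingLyapunov d (x b) (y b) ≤ superTwistingLyapunov d (x a) (y a) := by
  obtain ⟨K, hK⟩ := h.lipschitz_lyapunov b
  have hac : AbsolutelyContinuousOnInterval
      (fun t => superTwistingLyapunov d (x t) (y t)) a b :=
    (hK.mono (by rw [uIcc_of_le hab]; exact Icc_subset_Icc_left ha)).absolutelyContinuousOnInterval
  have := hac.sub_le_of_deriv_le (C := 0) hab (by
    filter_upwards [h.ae_lyapunov_deriv hd] with t ht hmem
    obtain ⟨v, hv, hle⟩ := ht (ha.trans_lt hmem.1)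
    exact ⟨v, hle.trans (by
      have := abs_nonneg (x t)
      have h2 : 0 ≤ d ^ 2 / 4 * (16 * d ^ 2 * |x t| + y t ^ 2) := by positivity
      linarith), hv⟩)
  linarith

/-- The decrease rate dominates V^{2/3}, so V^{1/3} falls at speed at least d²/12. Since V is
nonincreasing, positivity at `b` forces positivity on all of [a, b], where the cube root is smooth.
-/
theorem lyapunov_rpow_le (hd : 0 < d) (h : IsSuperTwistingTrajectory d x y) {a b : ℝ} (ha : 0 ≤ a)
    (hab : a ≤ b) (hb : 0 < superTwistingLyapunov d (x b) (y b)) :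
    d ^ 2 / 12 * (b - a) ≤ superTwistingLyapunov d (x a) (y a) ^ (1 / 3 : ℝ) := by
  obtain ⟨K, hK⟩ := h.lipschitz_lyapunov b
  have hK' := hK.mono (Icc_subset_Icc_left ha)
  have hpos : ∀ t ∈ Icc a b, 0 < superTwistingLyapunov d (x t) (y t) := fun t ht =>
    hb.trans_le (h.lyapunov_antitone hd (ha.trans ht.1) ht.2)
  obtain ⟨K', hG⟩ := ContDiffOn.comp_lipschitzOnWith (u := Ioi 0) (convex_Ioi 0)
    (g := fun v : ℝ => v ^ (1 / 3 : ℝ))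
    (fun v hv => (Real.contDiffAt_rpow_const_of_ne (ne_of_gt hv)).contDiffWithinAt) hK' hpos
  have hac : AbsolutelyContinuousOnInterval
      (fun t => superTwistingLyapunov d (x t) (y t) ^ (1 / 3 : ℝ)) a b :=
    (hG.mono (by rw [uIcc_of_le hab])).absolutelyContinuousOnInterval
  have := hac.sub_le_of_deriv_le (C := -(d ^ 2 / 12)) hab (by
    filter_upwards [h.ae_lyapunov_deriv hd] with t ht hmem
    obtain ⟨v, hv, hle⟩ := ht (ha.trans_lt hmem.1)
    have hV := hpos t (Ioo_subset_Icc_self hmem)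
    refine ⟨_, ?_, hv.rpow_const (Or.inl hV.ne')⟩
    have hup := superTwistingLyapunov_le hd (x t) (y t)
    set V := superTwistingLyapunov d (x t) (y t)
    set N := 16 * d ^ 2 * |x t| + y t ^ 2 with hN
    have hN0 : 0 ≤ N := by positivity
    have h1 : V ^ (2 / 3 : ℝ) ≤ N := by
      calc V ^ (2 / 3 : ℝ) ≤ (√N ^ 3) ^ (2 / 3 : ℝ) := by gcongr
        _ = N := by
          rw [← Real.rpow_natCast, ← Real.rpow_mul (Real.sqrt_nonneg _)]
          norm_num
          exact Real.sq_sqrt hN0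
    have h2 : V ^ (1 / 3 - 1 : ℝ) * V ^ (2 / 3 : ℝ) = 1 := by
      rw [← Real.rpow_add hV]; norm_num
    have h3 : 0 < V ^ (1 / 3 - 1 : ℝ) := Real.rpow_pos_of_pos hV _
    have h4 : V ^ (1 / 3 - 1 : ℝ) * v ≤ V ^ (1 / 3 - 1 : ℝ) * (-(d ^ 2 / 4) * V ^ (2 / 3 : ℝ)) := by
      refine mul_le_mul_of_nonneg_left (hle.trans ?_) h3.le
      have : 0 ≤ d ^ 2 / 4 := by positivity
      nlinarith
    nlinarith)
  have h5 := Real.rpow_nonneg hb.le (1 / 3 : ℝ)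
  linarith

end IsSuperTwistingTrajectory

/-! ### Equilibrium, stability and finite-time convergence of super-twisting. -/

theorem exists_superTwisting_lyapunov_lt {d : ℝ} (hd : 0 < d) {ε : ℝ} (hε : 0 < ε) :
    ∃ η, 0 < η ∧ ∀ x y, superTwistingLyapunov d x y < η → |x| < ε ∧ |y| < ε := by
  refine ⟨min (64 * d ^ 3 * (ε * √ε) / 24) (ε ^ 3 / 24), by positivity, fun x y hV => ?_⟩
  have hlow := le_superTwistingLyapunov hd x y
  have h1 := hV.trans_le (min_le_left _ _)
  have h2 := hV.trans_le (min_le_right _ _)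
  constructor
  · by_contra! hx
    have : ε * √ε ≤ |x| * √|x| := by gcongr
    have h3 : 64 * d ^ 3 * (ε * √ε) ≤ 64 * d ^ 3 * (|x| * √|x|) := by gcongr
    have : 0 ≤ |y| ^ 3 := by positivity
    linarith
  · by_contra! hy
    have : ε ^ 3 ≤ |y| ^ 3 := by gcongr
    have : 0 ≤ 64 * d ^ 3 * (|x| * √|x|) := by positivity
    linarith

theorem eq_zero_of_superTwistingLyapunov_eq_zero {d : ℝ} (hd : 0 < d) {x y : ℝ}
    (h : superTwistingLyapunov d x y = 0) : x = 0 ∧ y = 0 := by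
  have key : ∀ ε, 0 < ε → |x| < ε ∧ |y| < ε := fun ε hε => by
    obtain ⟨η, hη, H⟩ := exists_superTwisting_lyapunov_lt hd hε
    exact H x y (h ▸ hη)
  constructor
  · by_contra hx
    exact lt_irrefl _ (key _ (abs_pos.2 hx)).1
  · by_contra hy
    exact lt_irrefl _ (key _ (abs_pos.2 hy)).2

theorem superTwisting_equilibrium {d : ℝ} (hd : 0 < d) {x y : ℝ → ℝ}
    (h : IsSuperTwistingTrajectory d x y) {a b : ℝ} (ha : 0 ≤ a) (hab : a ≤ b) (hx : x a = 0)
    (hy : y a = 0) : x b = 0 ∧ y b = 0 := by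
  have h1 := h.lyapunov_antitone hd ha hab
  rw [hx, hy, superTwistingLyapunov_zero] at h1
  exact eq_zero_of_superTwistingLyapunov_eq_zero hd
    (h1.antisymm (superTwistingLyapunov_nonneg hd _ _))

theorem superTwisting_stable {d : ℝ} (hd : 0 < d) {ε : ℝ} (hε : 0 < ε) :
    ∃ δ, 0 < δ ∧ ∀ x y, IsSuperTwistingTrajectory d x y → ∀ a b, 0 ≤ a → a ≤ b →
      |x a| < δ → |y a| < δ → |x b| < ε ∧ |y b| < ε := by
  obtain ⟨η, hη, H⟩ := exists_superTwisting_lyapunov_lt hd hε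
  have hc := (continuous_superTwistingLyapunov d).continuousAt (x := ((0 : ℝ), (0 : ℝ)))
  obtain ⟨δ, hδ, Hδ⟩ := Metric.continuousAt_iff.1 hc η hη
  refine ⟨δ, hδ, fun x y h a b ha hab hx hy => H _ _ ?_⟩
  refine (h.lyapunov_antitone hd ha hab).trans_lt ?_
  have := @Hδ (x a, y a) (by simpa [Prod.dist_eq] using ⟨hx, hy⟩)
  simp only [superTwistingLyapunov_zero, Real.dist_eq, sub_zero] at this
  exact (le_abs_self _).trans_lt this

theorem superTwisting_finite_time {d : ℝ} (hd : 0 < d) (R : ℝ) :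
    ∃ T, 0 < T ∧ ∀ x y, IsSuperTwistingTrajectory d x y → ∀ a b, 0 ≤ a → a + T ≤ b →
      |x a| ≤ R → |y a| ≤ R → x b = 0 ∧ y b = 0 := by
  obtain ⟨M, hM⟩ :=
      (isCompact_Icc (a := ((-R, -R) : ℝ × ℝ)) (b := (R, R))).exists_bound_of_continuousOn
    (continuous_superTwistingLyapunov d).continuousOn
  have hM0 : 0 ≤ |M| ^ (1 / 3 : ℝ) := by positivity
  -- `M` bounds V on the square of side 2R, and V^{1/3} loses d²/12 per unit time. The extra 1 makes
  -- the contradiction strict.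
  refine ⟨12 / d ^ 2 * (|M| ^ (1 / 3 : ℝ) + 1), by positivity, fun x y h a b ha hab hx hy => ?_⟩
  have hT : 0 < 12 / d ^ 2 * (|M| ^ (1 / 3 : ℝ) + 1) := by positivity
  refine eq_zero_of_superTwistingLyapunov_eq_zero hd ?_
  by_contra hne
  have hpos := lt_of_le_of_ne (superTwistingLyapunov_nonneg hd (x b) (y b)) (Ne.symm hne)
  have h1 := h.lyapunov_rpow_le hd ha (by linarith) hpos
  have h2 := hM (x a, y a) ⟨⟨(abs_le.1 hx).1, (abs_le.1 hy).1⟩, ⟨(abs_le.1 hx).2, (abs_le.1 hy).2⟩⟩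
  have h3 : superTwistingLyapunov d (x a) (y a) ^ (1 / 3 : ℝ) ≤ |M| ^ (1 / 3 : ℝ) := by
    have h0 := superTwistingLyapunov_nonneg hd (x a) (y a)
    have := (le_abs_self _).trans (h2.trans (le_abs_self M))
    gcongr
  have h4 : d ^ 2 / 12 * (12 / d ^ 2 * (|M| ^ (1 / 3 : ℝ) + 1)) ≤ d ^ 2 / 12 * (b - a) := by
    gcongr; linarith
  have h5 : d ^ 2 / 12 * (12 / d ^ 2 * (|M| ^ (1 / 3 : ℝ) + 1)) = |M| ^ (1 / 3 : ℝ) + 1 := by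
    field_simp
  linarith

/-! ### Filippov regularisation. -/

section Filippov

variable {E : Type*} [NormedAddCommGroup E] [NormedSpace ℝ E] [MeasureSpace E]

theorem filippovMap_subset {f : E → E} {x : E} {δ : ℝ} (hδ : 0 < δ) {C : Set E} (hC : IsClosed C)
    (hconv : Convex ℝ C) (hf : ∀ y ∈ Metric.ball x δ, f y ∈ C) : filippovMap f x ⊆ C := by
  intro v hv
  refine closure_minimal (convexHull_min ?_ hconv) hC (hv δ hδ ∅ measure_empty)
  rintro _ ⟨y, hy, rfl⟩
  exact hf y hy.1

/-- Regularisation does not enlarge a linear image of the field that is continuous at `x`: nearby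
values lie in arbitrarily small closed balls, which are closed and convex. -/
theorem map_eq_of_mem_filippovMap {F : Type*} [NormedAddCommGroup F] [NormedSpace ℝ F]
    (L : E →L[ℝ] F)
    {f : E → E} {x v : E} {g : E → F} (hg : ContinuousAt g x) (hfg : ∀ y, L (f y) = g y)
    (hv : v ∈ filippovMap f x) : L v = g x := by
  refine eq_of_forall_dist_le fun ε hε => ?_
  obtain ⟨δ, hδ, hball⟩ := Metric.continuousAt_iff.1 hg ε hε
  refine filippovMap_subset (C := L ⁻¹' Metric.closedBall (g x) ε) hδ
    (Metric.isClosed_closedBall.preimage L.continuous)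
    ((convex_closedBall _ _).linear_preimage L.toLinearMap) (fun y hy => ?_) hv
  simpa [hfg] using (hball hy).le

end Filippov

/-- Needed so that deleting a null set in `filippovMap` cannot delete a whole open region of states.
-/
theorem LastLayerState.isOpenPosMeasure_volume (p m : ℕ) :
    (volume : Measure (LastLayerState p m)).IsOpenPosMeasure :=
  have : (volume : Measure ((Fin m → Fin p → ℝ) × (Fin m → ℝ))).IsOpenPosMeasure :=
    Measure.prod.instIsOpenPosMeasure (X := Fin m → Fin p → ℝ) (Y := Fin m → ℝ) (μ := volume)
      (ν := volume)
  have : SFinite (volume : Measure ((Fin m → Fin p → ℝ) × (Fin m → ℝ))) :=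
    Measure.prod.instSFinite
  Measure.prod.instIsOpenPosMeasure (X := Fin m → ℝ) (Y := (Fin m → Fin p → ℝ) × (Fin m → ℝ))
    (μ := volume) (ν := volume)

theorem abs_sign_le_one (r : ℝ) : |Real.sign r| ≤ 1 := by
  rcases Real.sign_apply_eq r with h | h | h <;> simp [h]

namespace HiddenLayers

theorem locallyLipschitz_output {n p : ℕ} {φ : ℝ → ℝ} (hφ : LocallyLipschitz φ)
    (N : HiddenLayers n p) : LocallyLipschitz (N.output φ) := by
  have affine : ∀ {q r : ℕ} (W : Matrix (Fin r) (Fin q) ℝ) (b : Fin r → ℝ),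
      LocallyLipschitz fun x => W.mulVec x + b := by
    intro q r W b
    refine LocallyLipschitz.pi fun j => ContDiff.locallyLipschitz (𝕂 := ℝ) ?_
    simp only [Pi.add_apply, Matrix.mulVec, dotProduct]
    fun_prop
  induction N with
  | first W b => exact affine W b
  | next N W b ih =>
    have h : LocallyLipschitz fun x j => φ (N.output φ x j) := LocallyLipschitz.pi fun j =>
      hφ.comp ((LipschitzWith.eval j).locallyLipschitz.comp ih)
    exact (affine W b).comp h

end HiddenLayers

/-! ### The regularised update laws in explicit form. -/

namespace OnlineTask

variable {n p m : ℕ}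

/-- The set-valued right-hand side of the closed loop: the Filippov regularisation of `updateField`
in explicit form. -/
structure IsUpdateVelocity (S : OnlineTask n p m) (k₁ k₂ t : ℝ) (X v : LastLayerState p m) :
    Prop where
  bias : v.1 = S.biasLaw k₁ t X
  weight : v.2.1 = S.weightLaw k₁ t X
  rate_pos : ∀ i, 0 < S.e₁ t X i → v.2.2 i = -k₂
  rate_neg : ∀ i, S.e₁ t X i < 0 → v.2.2 i = k₂
  rate_le : ∀ i, |v.2.2 i| ≤ k₂

section StateContinuity

variable (S : OnlineTask n p m) (k₁ k₂ t : ℝ)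

theorem continuous_e₁ (i : Fin m) : Continuous fun X => S.e₁ t X i := by
  unfold e₁ output
  fun_prop

theorem continuous_Gamma (i : Fin m) : Continuous fun X => S.Gamma t X i := by
  unfold Gamma
  fun_prop

theorem continuous_biasLaw : Continuous (S.biasLaw k₁ t) := by
  refine continuous_pi fun i => ?_
  unfold biasLaw
  have h := continuous_sqrt_abs_mul_sign.comp (S.continuous_e₁ t i)
  have h2 := S.continuous_Gamma t i
  simp only [mul_assoc (-k₁)]
  simp only [Function.comp_def] at h
  fun_prop

theorem continuous_weightLaw : Continuous (S.weightLaw k₁ t) := by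
  refine continuous_pi fun i => continuous_pi fun j => ?_
  exact ((continuous_apply i).comp (S.continuous_biasLaw k₁ t)).mul_const _

variable {k₂ t} in
theorem isUpdateVelocity_updateField (hk₂ : 0 ≤ k₂) (X : LastLayerState p m) :
    S.IsUpdateVelocity k₁ k₂ t X (S.updateField k₁ k₂ t X) where
  bias := rfl
  weight := rfl
  rate_pos i hi := by simp [updateField, Real.sign_of_pos hi]
  rate_neg i hi := by simp [updateField, Real.sign_of_neg hi]
  rate_le i := by
    simp only [updateField, abs_mul, abs_neg, abs_of_nonneg hk₂]
    exact mul_le_of_le_one_right hk₂ (abs_sign_le_one _)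

variable {k₁ k₂ t} in
theorem IsUpdateVelocity.of_mem_filippovMap (hk₂ : 0 ≤ k₂) {X v : LastLayerState p m}
    (hv : v ∈ filippovMap (S.updateField k₁ k₂ t) X) : S.IsUpdateVelocity k₁ k₂ t X v := by
  let fstL := ContinuousLinearMap.fst ℝ (Fin m → ℝ) ((Fin m → Fin p → ℝ) × (Fin m → ℝ))
  let sndL := ContinuousLinearMap.snd ℝ (Fin m → ℝ) ((Fin m → Fin p → ℝ) × (Fin m → ℝ))
  let fstR := ContinuousLinearMap.fst ℝ (Fin m → Fin p → ℝ) (Fin m → ℝ)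
  let sndR := ContinuousLinearMap.snd ℝ (Fin m → Fin p → ℝ) (Fin m → ℝ)
  let rate (i : Fin m) : LastLayerState p m →L[ℝ] ℝ :=
    (ContinuousLinearMap.proj (R := ℝ) (φ := fun _ : Fin m => ℝ) i).comp (sndR.comp sndL)
  refine ⟨?_, ?_, fun i hi => ?_, fun i hi => ?_, fun i => ?_⟩
  · exact map_eq_of_mem_filippovMap fstL (S.continuous_biasLaw k₁ t).continuousAt
      (fun _ => rfl) hv
  · exact map_eq_of_mem_filippovMap (fstR.comp sndL) (S.continuous_weightLaw k₁ t).continuousAt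
      (fun _ => rfl) hv
  · obtain ⟨δ, hδ, hball⟩ := Metric.eventually_nhds_iff_ball.1
      ((S.continuous_e₁ t i).continuousAt.eventually (lt_mem_nhds hi))
    refine filippovMap_subset (C := rate i ⁻¹' {-k₂}) hδ
      (isClosed_singleton.preimage (rate i).continuous)
      ((convex_singleton _).linear_preimage (rate i).toLinearMap) (fun Y hY => ?_) hv
    exact (S.isUpdateVelocity_updateField k₁ hk₂ Y).rate_pos i (hball Y hY)
  · obtain ⟨δ, hδ, hball⟩ := Metric.eventually_nhds_iff_ball.1
      ((S.continuous_e₁ t i).continuousAt.eventually (gt_mem_nhds hi))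
    refine filippovMap_subset (C := rate i ⁻¹' {k₂}) hδ
      (isClosed_singleton.preimage (rate i).continuous)
      ((convex_singleton _).linear_preimage (rate i).toLinearMap) (fun Y hY => ?_) hv
    exact (S.isUpdateVelocity_updateField k₁ hk₂ Y).rate_neg i (hball Y hY)
  · have : v ∈ rate i ⁻¹' Icc (-k₂) k₂ :=
      filippovMap_subset one_pos (isClosed_Icc.preimage (rate i).continuous)
        ((convex_Icc _ _).linear_preimage (rate i).toLinearMap)
        (fun Y _ => abs_le.1 ((S.isUpdateVelocity_updateField k₁ hk₂ Y).rate_le i)) hv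
    exact abs_le.2 this

variable {t} in
-- Moving the bias by (r/2)σ moves each component of e₁ by exactly (r/2)σᵢ, so every sign pattern
-- compatible with `X` occurs on a nonempty open set near `X`, hence off `N`.
theorem exists_sign_e₁_eq {X : LastLayerState p m} {σ : Fin m → ℝ} (hσ : ∀ i, |σ i| = 1)
    (hX : ∀ i, 0 ≤ σ i * S.e₁ t X i) {r : ℝ} (hr : 0 < r) {N : Set (LastLayerState p m)}
    (hN : volume N = 0) : ∃ Y ∈ Metric.ball X r \ N, ∀ i, Real.sign (S.e₁ t Y i) = σ i := by
  let U : Set (LastLayerState p m) := Metric.ball X r ∩ ⋂ i, {Y | 0 < σ i * S.e₁ t Y i}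
  have hU : IsOpen U := Metric.isOpen_ball.inter <| isOpen_iInter_of_finite fun i =>
    isOpen_lt continuous_const (continuous_const.mul (S.continuous_e₁ t i))
  have hne : U.Nonempty := by
    refine ⟨X + ((r / 2) • σ, 0, 0), ?_, mem_iInter.2 fun i => ?_⟩
    · have hnorm : ‖σ‖ ≤ 1 := (pi_norm_le_iff_of_nonneg zero_le_one).2 fun i => (hσ i).le
      simp only [Metric.mem_ball, dist_self_add_left, Prod.norm_def, norm_zero, norm_smul,
        Real.norm_eq_abs, abs_of_pos (half_pos hr)]
      have : r / 2 * ‖σ‖ ≤ r / 2 := mul_le_of_le_one_right (by positivity) hnorm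
      have h2 : (0 : ℝ) ≤ r / 2 * ‖σ‖ := by positivity
      simp only [max_self, max_eq_left h2]
      linarith
    · have e : S.e₁ t (X + ((r / 2) • σ, 0, 0)) i = S.e₁ t X i + r / 2 * σ i := by
        simp [e₁, output]; ring
      have h1 : σ i * σ i = 1 := by rw [← abs_mul_abs_self, hσ i, one_mul]
      show 0 < σ i * S.e₁ t (X + ((r / 2) • σ, 0, 0)) i
      rw [e]
      nlinarith [hX i]
  have := LastLayerState.isOpenPosMeasure_volume p m
  have hpos : 0 < volume U := hU.measure_pos _ hne
  obtain ⟨Y, hYU, hYN⟩ : ∃ Y ∈ U, Y ∉ N := by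
    by_contra! h
    exact hpos.ne' (measure_mono_null h hN)
  refine ⟨Y, ⟨hYU.1, hYN⟩, fun i => ?_⟩
  have h : 0 < σ i * S.e₁ t Y i := mem_iInter.1 hYU.2 i
  rcases eq_or_eq_neg_of_abs_eq (hσ i) with h1 | h1 <;> rw [h1] at h ⊢
  · exact Real.sign_of_pos (by linarith)
  · exact Real.sign_of_neg (by linarith)

variable {k₁ k₂ t} in
-- The admissible rates form a box whose vertices are limits of field values off any null set. The
-- convex hull of a product is the product of the convex hulls, so the whole box is reached.
theorem IsUpdateVelocity.mem_filippovMap {X v : LastLayerState p m}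
    (hv : S.IsUpdateVelocity k₁ k₂ t X v) : v ∈ filippovMap (S.updateField k₁ k₂ t) X := by
  intro δ hδ N hN
  -- The extreme rates of component `i`: a single value when its error is nonzero, both k₂ and -k₂
  -- when it vanishes.
  let A : Fin m → Set ℝ := fun i => {c | ∃ σ : ℝ, |σ| = 1 ∧ 0 ≤ σ * S.e₁ t X i ∧ c = -k₂ * σ}
  have hA : {S.biasLaw k₁ t X} ×ˢ {S.weightLaw k₁ t X} ×ˢ univ.pi A ⊆
      closure (convexHull ℝ (S.updateField k₁ k₂ t '' (Metric.ball X δ \ N))) := by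
    rintro ⟨a, b, c⟩ ⟨rfl, rfl, hc⟩
    choose σ hσ1 hσ2 hσ3 using fun i => hc i (mem_univ i)
    refine closure_mono (subset_convexHull ℝ _) (Metric.mem_closure_iff.2 fun ε hε => ?_)
    obtain ⟨r, hr, hball⟩ := Metric.continuousAt_iff.1
      ((S.continuous_biasLaw k₁ t).prodMk (S.continuous_weightLaw k₁ t)).continuousAt ε hε
    obtain ⟨Y, hY, hs⟩ := S.exists_sign_e₁_eq hσ1 hσ2 (lt_min hr hδ) hN
    refine ⟨_, ⟨Y, ⟨Metric.ball_subset_ball (min_le_right _ _) hY.1, hY.2⟩, rfl⟩, ?_⟩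
    have h1 := hball (Metric.ball_subset_ball (min_le_left _ _) hY.1)
    rw [Prod.dist_eq, max_lt_iff] at h1
    have h2 : (fun i => -k₂ * Real.sign (S.e₁ t Y i)) = c := by
      funext i; rw [hs]; exact (hσ3 i).symm
    rw [dist_comm, updateField, h2, Prod.dist_eq, Prod.dist_eq, dist_self]
    exact max_lt h1.1 (max_lt h1.2 hε)
  refine convexHull_min hA (convex_convexHull ℝ _).closure ?_
  rw [convexHull_prod, convexHull_prod, convexHull_singleton, convexHull_singleton, convexHull_pi]
  refine ⟨hv.bias, hv.weight, fun i _ => ?_⟩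
  rcases lt_trichotomy (S.e₁ t X i) 0 with h | h | h
  · exact subset_convexHull ℝ _ ⟨-1, by simp, by linarith, by rw [hv.rate_neg i h]; ring⟩
  · have h1 : -k₂ ∈ A i := ⟨1, by simp, by simp [h], by ring⟩
    have h2 : k₂ ∈ A i := ⟨-1, by simp, by simp [h], by ring⟩
    have hk := abs_le.1 (hv.rate_le i)
    refine (convex_convexHull ℝ (A i)).segment_subset (subset_convexHull ℝ _ h1)
      (subset_convexHull ℝ _ h2) ?_
    rw [segment_eq_Icc (hk.1.trans hk.2)]
    exact hk
  · exact subset_convexHull ℝ _ ⟨1, by simp, by linarith, by rw [hv.rate_pos i h]; ring⟩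

end StateContinuity

/-! ### Regularity of the last-layer input and of the target. -/

namespace Admissible

variable {S : OnlineTask n p m} {D : ℝ} (h : S.Admissible D)
include h

theorem exists_lipschitzOnWith_feature (T : ℝ) : ∃ K, LipschitzOnWith K S.feature (Icc 0 T) := by
  have hx : ContDiffOn ℝ 1 S.x (Icc 0 T) := h.contDiffOn_input.mono Icc_subset_Ici_self
  obtain ⟨K, hK⟩ := hx.exists_lipschitzOnWith one_ne_zero (convex_Icc 0 T) isCompact_Icc
  have hloc : LocallyLipschitz fun y j => S.φ (S.hidden.output S.φ y j) :=
    LocallyLipschitz.pi fun j => h.locallyLipschitz_activation.comp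
      ((LipschitzWith.eval j).locallyLipschitz.comp
        (S.hidden.locallyLipschitz_output h.locallyLipschitz_activation))
  obtain ⟨C, hC⟩ :=
      (hloc.locallyLipschitzOn (s := S.x '' Icc 0 T)).exists_lipschitzOnWith_of_compact
    (isCompact_Icc.image_of_continuousOn hK.continuousOn)
  exact ⟨C * K, hC.comp hK (mapsTo_image _ _)⟩

theorem continuousOn_feature : ContinuousOn S.feature (Ici 0) := by
  intro t ht
  obtain ⟨K, hK⟩ := h.exists_lipschitzOnWith_feature (t + 1)
  have ht0 : (0 : ℝ) ≤ t := ht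
  refine (hK.continuousOn t ⟨ht0, by linarith⟩).mono_of_mem_nhdsWithin ?_
  filter_upwards [self_mem_nhdsWithin,
    mem_nhdsWithin_of_mem_nhds (Iio_mem_nhds (lt_add_one t))] with s h1 h2
  exact ⟨h1, le_of_lt h2⟩

theorem continuousOn_feature_apply (j : Fin p) : ContinuousOn (fun t => S.feature t j) (Ici 0) :=
  (continuous_apply j).comp_continuousOn h.continuousOn_feature

theorem exists_lipschitzOnWith_feature_apply (T : ℝ) (j : Fin p) :
    ∃ K, LipschitzOnWith K (fun t => S.feature t j) (Icc 0 T) := by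
  obtain ⟨K, hK⟩ := h.exists_lipschitzOnWith_feature T
  exact ⟨1 * K, (LipschitzWith.eval j).comp_lipschitzOnWith hK⟩

theorem ae_differentiableAt_feature :
    ∀ᵐ t : ℝ, 0 < t → ∀ j, DifferentiableAt ℝ (fun s => S.feature s j) t := by
  have key : ∀ (j : Fin p) (N : ℕ), ∀ᵐ t : ℝ, t ∈ uIcc (0 : ℝ) N →
      DifferentiableAt ℝ (fun s => S.feature s j) t := fun j N => by
    obtain ⟨K, hK⟩ := h.exists_lipschitzOnWith_feature_apply N j
    rw [← uIcc_of_le (Nat.cast_nonneg N)] at hK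
    exact hK.absolutelyContinuousOnInterval.ae_differentiableAt
  filter_upwards [ae_all_iff.2 fun j => ae_all_iff.2 (key j)] with t ht h0 j
  obtain ⟨N, hN⟩ := exists_nat_ge t
  exact ht j N (by rw [uIcc_of_le (Nat.cast_nonneg N)]; exact ⟨h0.le, hN⟩)

theorem exists_deriv_feature_le (T : ℝ) (j : Fin p) :
    ∃ B, ∀ t ∈ Ioc 0 T, |deriv (fun s => S.feature s j) t| ≤ B := by
  -- The margin 1 makes `T` an interior point. Time 0 is excluded because the two-sided derivative
  -- there would see negative times.
  obtain ⟨K, hK⟩ := h.exists_lipschitzOnWith_feature_apply (T + 1) j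
  exact ⟨K, fun t ht => hK.norm_deriv_le (Icc_mem_nhds ht.1 (by linarith [ht.2]))⟩

theorem sum_sq_feature_pos {t : ℝ} (ht : 0 ≤ t) : 0 < ∑ l, S.feature t l ^ 2 := by
  obtain ⟨l, hl⟩ := Function.ne_iff.1 (h.feature_ne_zero t ht)
  exact Finset.sum_pos' (fun _ _ => sq_nonneg _) ⟨l, Finset.mem_univ l, by
    have : S.feature t l ≠ 0 := hl
    positivity⟩

theorem contDiffOn_deriv_target :
    ContDiffOn ℝ 1 (derivWithin S.target (Ici 0)) (Ici 0) :=
  h.contDiffOn_target.derivWithin (uniqueDiffOn_Ici 0) (by norm_num)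

theorem hasDerivAt_target {t : ℝ} (ht : 0 < t) :
    HasDerivAt S.target (derivWithin S.target (Ici 0) t) t :=
  ((h.contDiffOn_target.differentiableOn (by norm_num)) t ht.le).hasDerivWithinAt.hasDerivAt
    (Ici_mem_nhds ht)

theorem hasDerivAt_deriv_target {t : ℝ} (ht : 0 < t) :
    HasDerivAt (derivWithin S.target (Ici 0)) (iteratedDerivWithin 2 S.target (Ici 0) t) t := by
  have e : iteratedDerivWithin 2 S.target (Ici 0) t =
      derivWithin (derivWithin S.target (Ici 0)) (Ici 0) t := by
    rw [iteratedDerivWithin_succ]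
    congr 1
    exact iteratedDerivWithin_one
  rw [e]
  exact ((h.contDiffOn_deriv_target.differentiableOn (by norm_num)) t
    ht.le).hasDerivWithinAt.hasDerivAt (Ici_mem_nhds ht)

end Admissible

end OnlineTask

/-! ### Linear growth and absence of blow-up. -/

/-- `|g t x| ≤ C (1 + ‖x‖)` uniformly for `t ∈ s`. -/
def HasLinearGrowthOn {E : Type*} [NormedAddCommGroup E] (s : Set ℝ) (g : ℝ → E → ℝ) : Prop :=
  ∃ C, 0 ≤ C ∧ ∀ t ∈ s, ∀ x, |g t x| ≤ C * (1 + ‖x‖)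

namespace HasLinearGrowthOn

variable {E : Type*} [NormedAddCommGroup E] {s : Set ℝ} {f g : ℝ → E → ℝ}

theorem of_le (hg : HasLinearGrowthOn s g) (h : ∀ t ∈ s, ∀ x, |f t x| ≤ |g t x|) :
    HasLinearGrowthOn s f := by
  obtain ⟨C, hC, H⟩ := hg
  exact ⟨C, hC, fun t ht x => (h t ht x).trans (H t ht x)⟩

theorem add (hf : HasLinearGrowthOn s f) (hg : HasLinearGrowthOn s g) :
    HasLinearGrowthOn s fun t x => f t x + g t x := by
  obtain ⟨C, hC, H⟩ := hf
  obtain ⟨C', hC', H'⟩ := hg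
  refine ⟨C + C', by positivity, fun t ht x => (abs_add_le _ _).trans ?_⟩
  rw [add_mul]
  exact add_le_add (H t ht x) (H' t ht x)

theorem mul_bounded (hf : HasLinearGrowthOn s f) {a : ℝ → ℝ} (ha : ∃ B, ∀ t ∈ s, |a t| ≤ B) :
    HasLinearGrowthOn s fun t x => f t x * a t := by
  obtain ⟨C, hC, H⟩ := hf
  obtain ⟨B, hB⟩ := ha
  refine ⟨C * |B|, by positivity, fun t ht x => ?_⟩
  rw [abs_mul, mul_right_comm]
  exact mul_le_mul (H t ht x) ((hB t ht).trans (le_abs_self B)) (abs_nonneg _) (by positivity)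

theorem const_mul (hf : HasLinearGrowthOn s f) (c : ℝ) :
    HasLinearGrowthOn s fun t x => c * f t x := by
  simpa only [mul_comm] using hf.mul_bounded (a := fun _ => c) ⟨|c|, fun _ _ => le_rfl⟩

theorem of_bounded {a : ℝ → ℝ} (ha : ∃ B, ∀ t ∈ s, |a t| ≤ B) :
    HasLinearGrowthOn s fun t (_ : E) => a t := by
  obtain ⟨B, hB⟩ := ha
  refine ⟨|B|, abs_nonneg _, fun t ht x => ((hB t ht).trans (le_abs_self B)).trans ?_⟩
  nlinarith [abs_nonneg B, mul_nonneg (abs_nonneg B) (norm_nonneg x)]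

theorem sub (hf : HasLinearGrowthOn s f) (hg : HasLinearGrowthOn s g) :
    HasLinearGrowthOn s fun t x => f t x - g t x := by
  simpa [sub_eq_add_neg] using hf.add (hg.const_mul (-1))

theorem sum {ι : Type*} (I : Finset ι) {f : ι → ℝ → E → ℝ}
    (hf : ∀ i ∈ I, HasLinearGrowthOn s (f i)) :
    HasLinearGrowthOn s fun t x => ∑ i ∈ I, f i t x := by
  classical
  induction I using Finset.induction_on with
  | empty => exact ⟨0, le_rfl, by simp⟩
  | insert i I hi ih =>
    simp only [Finset.sum_insert hi]
    exact (hf i (Finset.mem_insert_self _ _)).add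
      (ih fun j hj => hf j (Finset.mem_insert_of_mem hj))

theorem sqrt_abs (hf : HasLinearGrowthOn s f) : HasLinearGrowthOn s fun t x => √|f t x| := by
  have h : HasLinearGrowthOn s fun t x => 1 + |f t x| :=
    (of_bounded (a := fun _ => 1) ⟨1, by simp⟩).add (hf.of_le (by simp))
  refine h.of_le fun t _ x => ?_
  rw [abs_of_nonneg (Real.sqrt_nonneg _), abs_of_nonneg (a := 1 + |f t x|) (by positivity)]
  refine Real.sqrt_le_iff.2 ⟨by positivity, ?_⟩
  nlinarith [abs_nonneg (f t x), sq_nonneg (f t x), sq_abs (f t x)]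

theorem exists_common {ι : Type*} [Finite ι] {f : ι → ℝ → E → ℝ}
    (hf : ∀ i, HasLinearGrowthOn s (f i)) :
    ∃ C, 0 ≤ C ∧ ∀ i, ∀ t ∈ s, ∀ x, |f i t x| ≤ C * (1 + ‖x‖) := by
  have := Fintype.ofFinite ι
  choose C hC H using hf
  refine ⟨∑ i, C i, Finset.sum_nonneg fun i _ => hC i, fun i t ht x => (H i t ht x).trans ?_⟩
  gcongr
  exact Finset.single_le_sum (fun i _ => hC i) (Finset.mem_univ i)

end HasLinearGrowthOn

/-- Start at `a` so close to `τ` that C(τ - a) ≤ 1/2. If ‖f‖ is maximal on [a, t] at `r`, then ‖f r‖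
≤ ‖f a‖ + (1 + ‖f r‖)/2, and the maximum is absorbed into the left side. -/
theorem exists_bound_of_linear_growth {E : Type*} [NormedAddCommGroup E] [NormedSpace ℝ E]
    {f : ℝ → E} {τ C : ℝ} (hτ : 0 < τ) (hC : 0 ≤ C)
    (hf : ∀ b ∈ Ico 0 τ, AbsolutelyContinuousOnInterval f 0 b)
    (h : ∀ᵐ t : ℝ, t ∈ Ioo 0 τ → ∃ v, ‖v‖ ≤ C * (1 + ‖f t‖) ∧ HasDerivAt f v t) :
    ∃ M, ∀ t ∈ Ico 0 τ, ‖f t‖ ≤ M := by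
  obtain ⟨a, ha0, haτ, haC⟩ : ∃ a, 0 ≤ a ∧ a < τ ∧ C * (τ - a) ≤ 1 / 2 := by
    have hη : 0 < 1 / (2 * (C + 1)) := by positivity
    refine ⟨max 0 (τ - 1 / (2 * (C + 1))), le_max_left _ _, max_lt hτ (by linarith), ?_⟩
    calc C * (τ - max 0 (τ - 1 / (2 * (C + 1)))) ≤ C * (1 / (2 * (C + 1))) := by
          gcongr
          linarith [le_max_right 0 (τ - 1 / (2 * (C + 1)))]
      _ ≤ 1 / 2 := by
          rw [mul_one_div, div_le_div_iff₀ (by positivity) (by positivity)]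
          linarith
  have hcont : ∀ b ∈ Ico 0 τ, ContinuousOn f (Icc 0 b) := fun b hb => by
    have := (hf b hb).continuousOn
    rwa [uIcc_of_le hb.1] at this
  obtain ⟨M, hM⟩ := isCompact_Icc.exists_bound_of_continuousOn (hcont a ⟨ha0, haτ⟩)
  refine ⟨max M (2 * ‖f a‖ + 1), fun t ht => ?_⟩
  rcases le_total t a with hta | hat
  · exact (hM t ⟨ht.1, hta⟩).trans (le_max_left _ _)
  refine le_max_of_le_right ?_
  obtain ⟨r, hr, hmax⟩ := isCompact_Icc.exists_isMaxOn (nonempty_Icc.2 hat)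
    ((hcont t ht).mono (Icc_subset_Icc_left ha0)).norm
  have hbound := ((hf t ht).mono (c := a) (d := r) (by
    rw [uIcc_of_le hr.1, uIcc_of_le ht.1]
    exact Icc_subset_Icc ha0 hr.2)).norm_sub_le_of_norm_deriv_le (C := C * (1 + ‖f r‖)) hr.1 (by
      filter_upwards [h] with s hs hmem
      obtain ⟨v, hv, hd⟩ := hs ⟨ha0.trans_lt hmem.1, (hmem.2.trans_le hr.2).trans ht.2⟩
      refine ⟨v, hv.trans ?_, hd⟩
      have : ‖f s‖ ≤ ‖f r‖ := hmax (a := s) ⟨hmem.1.le, hmem.2.le.trans hr.2⟩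
      gcongr)
  have h1 : ‖f t‖ ≤ ‖f r‖ := hmax (a := t) ⟨hat, le_rfl⟩
  have h2 : ‖f r‖ ≤ ‖f r - f a‖ + ‖f a‖ := by simpa using norm_add_le (f r - f a) (f a)
  have h3 : C * (r - a) ≤ 1 / 2 := le_trans (by gcongr; exact hr.2.trans ht.2.le) haC
  have h4 : C * (1 + ‖f r‖) * (r - a) ≤ 1 / 2 * (1 + ‖f r‖) := by
    rw [mul_right_comm]
    gcongr
  linarith

namespace OnlineTask

variable {n p m : ℕ}

namespace Admissible

variable {S : OnlineTask n p m} {D : ℝ} (h : S.Admissible D)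
include h

theorem exists_feature_bound (T : ℝ) (j : Fin p) : ∃ B, ∀ t ∈ Ioc 0 T, |S.feature t j| ≤ B := by
  obtain ⟨B, hB⟩ := isCompact_Icc.exists_bound_of_continuousOn
    ((h.continuousOn_feature_apply j).mono (Icc_subset_Ici_self : Icc 0 T ⊆ Ici 0))
  exact ⟨B, fun t ht => hB t (Ioc_subset_Icc_self ht)⟩

theorem continuousOn_normalized_feature (j : Fin p) :
    ContinuousOn (fun t => S.feature t j / ∑ l, S.feature t l ^ 2) (Ici 0) :=
  (h.continuousOn_feature_apply j).div
    (continuousOn_finsetSum _ fun l _ => (h.continuousOn_feature_apply l).pow 2)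
    fun _ ht => (h.sum_sq_feature_pos ht).ne'

theorem hasLinearGrowthOn_e₁ (T : ℝ) (i : Fin m) :
    HasLinearGrowthOn (Ioc 0 T) fun t X => S.e₁ t X i := by
  unfold e₁ output
  have hb : HasLinearGrowthOn (Ioc 0 T) fun _ (X : LastLayerState p m) => X.1 i :=
    ⟨1, zero_le_one, fun t _ X => by
      linarith [norm_le_pi_norm X.1 i, norm_fst_le X, Real.norm_eq_abs (X.1 i)]⟩
  have hW (j : Fin p) : HasLinearGrowthOn (Ioc 0 T) fun _ (X : LastLayerState p m) => X.2.1 i j :=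
    ⟨1, zero_le_one, fun t _ X => by
      linarith [norm_le_pi_norm X.2.1 i, norm_le_pi_norm (X.2.1 i) j, norm_fst_le X.2,
        norm_snd_le X, Real.norm_eq_abs (X.2.1 i j)]⟩
  refine ((HasLinearGrowthOn.sum _ fun j _ => (hW j).mul_bounded (h.exists_feature_bound T j)).add
    hb).sub (.of_bounded ?_)
  obtain ⟨B, hB⟩ := isCompact_Icc.exists_bound_of_continuousOn
    (h.contDiffOn_target.continuousOn.mono (Icc_subset_Ici_self : Icc 0 T ⊆ Ici 0))
  exact ⟨B, fun t ht => (norm_le_pi_norm (S.target t) i).trans (hB t (Ioc_subset_Icc_self ht))⟩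

theorem hasLinearGrowthOn_biasLaw (k₁ T : ℝ) (i : Fin m) :
    HasLinearGrowthOn (Ioc 0 T) fun t X => S.biasLaw k₁ t X i := by
  unfold biasLaw Gamma
  have hz : HasLinearGrowthOn (Ioc 0 T) fun _ (X : LastLayerState p m) => X.2.2 i :=
    ⟨1, zero_le_one, fun t _ X => by
      linarith [norm_le_pi_norm X.2.2 i, norm_snd_le X.2, norm_snd_le X,
        Real.norm_eq_abs (X.2.2 i)]⟩
  have hW (j : Fin p) : HasLinearGrowthOn (Ioc 0 T) fun _ (X : LastLayerState p m) => X.2.1 i j :=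
    ⟨1, zero_le_one, fun t _ X => by
      linarith [norm_le_pi_norm X.2.1 i, norm_le_pi_norm (X.2.1 i) j, norm_fst_le X.2,
        norm_snd_le X, Real.norm_eq_abs (X.2.1 i j)]⟩
  have hr : HasLinearGrowthOn (Ioc 0 T) fun t X =>
      -k₁ * √|S.e₁ t X i| * Real.sign (S.e₁ t X i) := by
    refine ((h.hasLinearGrowthOn_e₁ T i).sqrt_abs.const_mul (-k₁)).of_le fun t _ X => ?_
    rw [abs_mul _ (Real.sign _)]
    exact mul_le_of_le_one_right (abs_nonneg _) (abs_sign_le_one _)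
  exact ((hr.sub (.sum _ fun j _ => (hW j).mul_bounded (h.exists_deriv_feature_le T j))).add
    hz).const_mul _

theorem exists_velocity_growth (k₁ k₂ T : ℝ) :
    ∃ C, 0 ≤ C ∧ ∀ t ∈ Ioc 0 T, ∀ X v, S.IsUpdateVelocity k₁ k₂ t X v → ‖v‖ ≤ C * (1 + ‖X‖) := by
  obtain ⟨C₁, hC₁, H₁⟩ := HasLinearGrowthOn.exists_common (h.hasLinearGrowthOn_biasLaw k₁ T)
  obtain ⟨C₂, hC₂, H₂⟩ := HasLinearGrowthOn.exists_common (s := Ioc 0 T)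
    (f := fun (ij : Fin m × Fin p) t X => S.weightLaw k₁ t X ij.1 ij.2) fun ij => by
      refine (h.hasLinearGrowthOn_biasLaw k₁ T ij.1).mul_bounded ?_
      obtain ⟨B, hB⟩ := isCompact_Icc.exists_bound_of_continuousOn
        ((h.continuousOn_normalized_feature ij.2).mono (Icc_subset_Ici_self : Icc 0 T ⊆ Ici 0))
      exact ⟨B, fun t ht => hB t (Ioc_subset_Icc_self ht)⟩
  refine ⟨C₁ + C₂ + |k₂|, by positivity, fun t ht X v hv => ?_⟩
  have hX : 0 ≤ 1 + ‖X‖ := by positivity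
  have hp₁ := mul_nonneg hC₁ hX
  have hp₂ := mul_nonneg hC₂ hX
  have hp₃ := mul_nonneg (abs_nonneg k₂) hX
  have hnn : 0 ≤ (C₁ + C₂ + |k₂|) * (1 + ‖X‖) := by positivity
  refine norm_prod_le_iff.2 ⟨?_, norm_prod_le_iff.2 ⟨?_, ?_⟩⟩
  · rw [hv.bias]
    refine (pi_norm_le_iff_of_nonneg hnn).2 fun i => ?_
    rw [Real.norm_eq_abs]
    linarith [H₁ i t ht X]
  · rw [hv.weight]
    refine (pi_norm_le_iff_of_nonneg hnn).2 fun i => (pi_norm_le_iff_of_nonneg hnn).2 fun j => ?_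
    rw [Real.norm_eq_abs]
    linarith [H₂ (i, j) t ht X]
  · refine (pi_norm_le_iff_of_nonneg hnn).2 fun i => ?_
    rw [Real.norm_eq_abs]
    have := mul_nonneg (abs_nonneg k₂) (norm_nonneg X)
    linarith [hv.rate_le i, le_abs_self k₂]

/-- Linear growth keeps the state bounded up to `τ`, and then the velocity is bounded too. The
constant is uniform on [0, τ), so a limit at `τ` exists, which continuation needs. -/
theorem exists_lipschitzOnWith_solution {k₁ k₂ τ : ℝ} (hk₂ : 0 ≤ k₂) (hτ : 0 < τ)
    {X : ℝ → LastLayerState p m} (hX : S.FollowsUpdateLaws k₁ k₂ (Ico 0 τ) X) :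
    ∃ K, LipschitzOnWith K X (Ico 0 τ) := by
  obtain ⟨C, hC, H⟩ := h.exists_velocity_growth k₁ k₂ τ
  have hvel : ∀ᵐ t : ℝ, t ∈ Ioo 0 τ → ∃ v, ‖v‖ ≤ C * (1 + ‖X t‖) ∧ HasDerivAt X v t := by
    filter_upwards [hX.2] with t ht hmem
    obtain ⟨v, hv, hd⟩ := ht (Ioo_subset_Ico_self hmem)
    exact ⟨v, H t (Ioo_subset_Ioc_self hmem) _ _ (.of_mem_filippovMap S hk₂ hv), hd⟩
  obtain ⟨M, hM⟩ := exists_bound_of_linear_growth hτ hC hX.1 hvel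
  have hM0 : 0 ≤ M := (norm_nonneg _).trans (hM 0 ⟨le_rfl, hτ⟩)
  refine ⟨⟨C * (1 + M), by positivity⟩, lipschitzOnWith_of_absolutelyContinuous ordConnected_Ico
    (fun a ha b hb hab => (hX.1 b hb).mono ?_) ?_⟩
  · rw [uIcc_of_le hab, uIcc_of_le hb.1]
    exact Icc_subset_Icc_left ha.1
  · filter_upwards [hvel] with t ht hmem
    rw [interior_Ico] at hmem
    obtain ⟨v, hv, hd⟩ := ht hmem
    refine ⟨v, hv.trans ?_, hd⟩
    show _ ≤ C * (1 + M)
    have := hM t (Ioo_subset_Ico_self hmem)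
    gcongr

end Admissible

theorem FollowsUpdateLaws.mono {S : OnlineTask n p m} {k₁ k₂ : ℝ} {I J : Set ℝ}
    {X : ℝ → LastLayerState p m} (hX : S.FollowsUpdateLaws k₁ k₂ I X) (hJ : J ⊆ I) :
    S.FollowsUpdateLaws k₁ k₂ J X :=
  ⟨fun T hT => hX.1 T (hJ hT), hX.2.mono fun _ ht hmem => ht (hJ hmem)⟩

/-! ### Reduction of the error dynamics to super-twisting. -/

namespace Admissible

variable {S : OnlineTask n p m} {D : ℝ}

theorem hasDerivAt_e₁ (h : S.Admissible D) {k₁ k₂ t : ℝ} (ht : 0 < t)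
    (hdiff : ∀ j, DifferentiableAt ℝ (fun s => S.feature s j) t) {X : ℝ → LastLayerState p m}
    {v : LastLayerState p m} (hv : S.IsUpdateVelocity k₁ k₂ t (X t) v) (hX : HasDerivAt X v t)
    (i : Fin m) :
    HasDerivAt (fun s => S.e₁ s (X s) i)
      (-k₁ * √|S.e₁ t (X t) i| * Real.sign (S.e₁ t (X t) i) + S.e₂ t (X t) i) t := by
  have hb : HasDerivAt (fun s => (X s).1 i) (v.1 i) t :=
    hasDerivAt_pi.1 (hasFDerivAt_fst.comp_hasDerivAt t hX) i
  have hW (j : Fin p) : HasDerivAt (fun s => (X s).2.1 i j) (v.2.1 i j) t :=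
    hasDerivAt_pi.1 (hasDerivAt_pi.1 (hasFDerivAt_fst.comp_hasDerivAt t
      (hasFDerivAt_snd.comp_hasDerivAt t hX)) i) j
  have hy := hasDerivAt_pi.1 (h.hasDerivAt_target ht) i
  have hsum : HasDerivAt (fun s => ∑ j, (X s).2.1 i j * S.feature s j)
      (∑ j, (v.2.1 i j * S.feature t j + (X t).2.1 i j * deriv (fun s => S.feature s j) t)) t :=
    HasDerivAt.fun_sum fun j _ => (hW j).mul (hdiff j).hasDerivAt
  refine ((hsum.add hb).sub hy).congr_deriv ?_
  have hs := (h.sum_sq_feature_pos ht.le).ne'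
  have e : ∑ j, v.2.1 i j * S.feature t j = S.biasLaw k₁ t (X t) i := by
    rw [hv.weight]
    simp only [weightLaw]
    calc _ = S.biasLaw k₁ t (X t) i * ((∑ j, S.feature t j ^ 2) / ∑ l, S.feature t l ^ 2) := by
          rw [Finset.sum_div, Finset.mul_sum]
          exact Finset.sum_congr rfl fun j _ => by ring
      _ = _ := by rw [div_self hs, mul_one]
  rw [Finset.sum_add_distrib, e, hv.bias]
  simp only [biasLaw, e₂, Gamma]
  ring

theorem hasDerivAt_e₂ (h : S.Admissible D) {t : ℝ} (ht : 0 < t) {X : ℝ → LastLayerState p m}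
    {v : LastLayerState p m} (hX : HasDerivAt X v t) (i : Fin m) :
    HasDerivAt (fun s => S.e₂ s (X s) i)
      (v.2.2 i - iteratedDerivWithin 2 S.target (Ici 0) t i) t :=
  (hasDerivAt_pi.1 (hasFDerivAt_snd.comp_hasDerivAt t
    (hasFDerivAt_snd.comp_hasDerivAt t hX)) i).sub
    (hasDerivAt_pi.1 (h.hasDerivAt_deriv_target ht) i)

/-- The perturbation ÿ' is at most d² against the gain 2d², so off e₁ = 0 the rate of e₂ has modulus
in [d², 3d²] and sign opposite to e₁. -/
theorem isSuperTwistingTrajectory {d : ℝ} (h : S.Admissible (d ^ 2))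
    {X : ℝ → LastLayerState p m} (hX : S.FollowsUpdateLaws (4 * d) (2 * d ^ 2) (Ici 0) X)
    (i : Fin m) :
    IsSuperTwistingTrajectory d (fun t => S.e₁ t (X t) i) (fun t => S.e₂ t (X t) i) := by
  have hk₂ : 0 ≤ 2 * d ^ 2 := by positivity
  have hXL : ∀ T : ℝ, ∃ K, LipschitzOnWith K X (Icc 0 T) := fun T => by
    rcases lt_or_ge T 0 with hT | hT
    · exact ⟨0, by simp [Icc_eq_empty (not_le.2 hT)]⟩
    · obtain ⟨K, hK⟩ := h.exists_lipschitzOnWith_solution hk₂ (τ := T + 1) (by linarith)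
        (hX.mono Ico_subset_Ici_self)
      exact ⟨K, hK.mono fun t ht => ⟨ht.1, by linarith [ht.2]⟩⟩
  refine ⟨fun T => ?_, fun T => ?_, ?_⟩
  · obtain ⟨K, hK⟩ := hXL T
    obtain ⟨K', hK'⟩ := h.exists_lipschitzOnWith_feature T
    obtain ⟨K'', hK''⟩ := (h.contDiffOn_target.mono
      (Icc_subset_Ici_self : Icc 0 T ⊆ Ici 0)).exists_lipschitzOnWith two_ne_zero
        (convex_Icc 0 T) isCompact_Icc
    have hg : ContDiffOn ℝ 1 (fun z : LastLayerState p m × (Fin p → ℝ) × (Fin m → ℝ) =>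
        ∑ j, z.1.2.1 i j * z.2.1 j + z.1.1 i - z.2.2 i) univ := ContDiff.contDiffOn (by fun_prop)
    simpa only [e₁, output] using hg.comp_lipschitzOnWith convex_univ
      (hK.prodMk (hK'.prodMk hK'')) (mapsTo_univ _ _)
  · obtain ⟨K, hK⟩ := hXL T
    obtain ⟨K'', hK''⟩ := (h.contDiffOn_deriv_target.mono
      (Icc_subset_Ici_self : Icc 0 T ⊆ Ici 0)).exists_lipschitzOnWith one_ne_zero
        (convex_Icc 0 T) isCompact_Icc
    have hg : ContDiffOn ℝ 1 (fun z : LastLayerState p m × (Fin m → ℝ) => z.1.2.2 i - z.2 i)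
        univ := ContDiff.contDiffOn (by fun_prop)
    simpa only [e₂] using hg.comp_lipschitzOnWith convex_univ (hK.prodMk hK'') (mapsTo_univ _ _)
  · filter_upwards [hX.2, h.ae_differentiableAt_feature] with t ht hdiff h0
    obtain ⟨v, hv, hd⟩ := ht (mem_Ici.2 h0.le)
    replace hv := IsUpdateVelocity.of_mem_filippovMap S hk₂ hv
    refine ⟨_, _, h.hasDerivAt_e₁ h0 (hdiff h0) hv hd i, h.hasDerivAt_e₂ h0 hd i, rfl,
      fun hpos => ?_,
      fun hneg => ?_, ?_⟩
    all_goals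
      have hy := abs_le.1 (h.target_bound t h0.le i)
    · rw [hv.rate_pos i hpos]
      constructor <;> linarith
    · rw [hv.rate_neg i hneg]
      constructor <;> linarith
    · have hr := abs_le.1 (hv.rate_le i)
      exact abs_le.2 ⟨by linarith, by linarith⟩

end Admissible

end OnlineTask

theorem errorEquilibrium_of_sq {d : ℝ} (hd : 0 < d) :
    ErrorEquilibrium (d ^ 2) (4 * d) (2 * d ^ 2) := by
  intro n p m S h X hX t₀ ht₀ h1 h2 t ht
  have key := fun i => superTwisting_equilibrium hd (h.isSuperTwistingTrajectory hX i) ht₀ ht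
    (congrFun h1 i) (congrFun h2 i)
  exact ⟨funext fun i => (key i).1, funext fun i => (key i).2⟩

theorem robustlyStable_of_sq {d : ℝ} (hd : 0 < d) :
    RobustlyStable (d ^ 2) (4 * d) (2 * d ^ 2) := by
  intro ε hε
  obtain ⟨δ, hδ, H⟩ := superTwisting_stable hd hε
  refine ⟨δ, hδ, fun n p m S h X hX t₀ ht₀ h1 h2 t ht => ?_⟩
  have key := fun i => H _ _ (h.isSuperTwistingTrajectory hX i) t₀ t ht₀ ht
    ((norm_le_pi_norm _ i).trans_lt h1) ((norm_le_pi_norm _ i).trans_lt h2)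
  exact ⟨(pi_norm_lt_iff hε).2 fun i => (key i).1, (pi_norm_lt_iff hε).2 fun i => (key i).2⟩

theorem robustlyFiniteTimeConvergent_of_sq {d : ℝ} (hd : 0 < d) :
    RobustlyFiniteTimeConvergent (d ^ 2) (4 * d) (2 * d ^ 2) := by
  intro R _
  obtain ⟨T, hT, H⟩ := superTwisting_finite_time hd R
  refine ⟨T, hT, fun n p m S h X hX t₀ ht₀ h1 h2 t ht => ?_⟩
  have key := fun i => H _ _ (h.isSuperTwistingTrajectory hX i) t₀ t ht₀ ht
    ((norm_le_pi_norm _ i).trans h1) ((norm_le_pi_norm _ i).trans h2)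
  exact ⟨funext fun i => (key i).1, funext fun i => (key i).2⟩

/-! ### Compactness and delay approximations. -/

/-- Arzelà–Ascoli: a subsequence converges at all rationals by compactness of a countable product,
and the common Lipschitz constants carry the Cauchy property to every time. -/
theorem exists_subseq_tendsto_of_lipschitzOnWith {E : Type*} [NormedAddCommGroup E] [ProperSpace E]
    {X : ℕ → ℝ → E} {t₀ : ℝ} {x₀ : E} (h₀ : ∀ n, X n t₀ = x₀)
    (hX : ∀ T, ∃ K : ℝ≥0, ∀ n, LipschitzOnWith K (X n) (Iic T)) :
    ∃ φ : ℕ → ℕ, StrictMono φ ∧ ∃ Y : ℝ → E, ∀ t,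
      Tendsto (fun n => X (φ n) t) atTop (𝓝 (Y t)) := by
  have hb : ∀ q : ℚ, ∃ R, ∀ n, X n q ∈ Metric.closedBall x₀ R := fun q => by
    obtain ⟨K, hK⟩ := hX (max q t₀)
    exact ⟨K * dist (q : ℝ) t₀, fun n => by
      rw [Metric.mem_closedBall, ← h₀ n]
      exact (hK n).dist_le_mul _ (mem_Iic.2 (le_max_left _ _)) _ (mem_Iic.2 (le_max_right _ _))⟩
  choose R hR using hb
  obtain ⟨_, _, φ, hφ, hlim⟩ := (isCompact_univ_pi fun q : ℚ =>
    isCompact_closedBall x₀ (R q)).tendsto_subseq (x := fun n (q : ℚ) => X n q)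
    fun n q _ => hR q n
  rw [tendsto_pi_nhds] at hlim
  have hcauchy : ∀ t, CauchySeq fun n => X (φ n) t := fun t => by
    obtain ⟨K, hK⟩ := hX t
    refine Metric.cauchySeq_iff.2 fun ε hε => ?_
    obtain ⟨q, hq1, hq2⟩ := exists_rat_btwn (show t - ε / (3 * (K + 1)) < t by
      have : 0 < ε / (3 * ((K : ℝ) + 1)) := by positivity
      linarith)
    have hclose : ∀ n, dist (X (φ n) t) (X (φ n) q) ≤ ε / 3 := fun n => by
      refine ((hK (φ n)).dist_le_mul t (mem_Iic.2 le_rfl) q hq2.le).trans ?_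
      rw [Real.dist_eq, abs_of_pos (sub_pos.2 hq2)]
      calc (K : ℝ) * (t - q) ≤ (K + 1) * (ε / (3 * (K + 1))) :=
            mul_le_mul (by linarith) (by linarith) (by linarith) (by positivity)
        _ = ε / 3 := by field_simp
    obtain ⟨N, hN⟩ := Metric.cauchySeq_iff.1 (hlim q).cauchySeq (ε / 3) (by positivity)
    refine ⟨N, fun i hi j hj => ?_⟩
    have h1 := hN i hi j hj
    simp only [Function.comp_apply] at h1
    have h2 := dist_triangle4 (X (φ i) t) (X (φ i) q) (X (φ j) q) (X (φ j) t)
    have h3 := hclose i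
    have h4 := hclose j
    rw [dist_comm] at h4
    linarith
  choose Y hY using fun t => cauchySeq_tendsto_of_complete (hcauchy t)
  exact ⟨φ, hφ, Y, hY⟩

theorem lipschitzOnWith_of_tendsto {α E : Type*} [PseudoMetricSpace α] [PseudoMetricSpace E]
    {X : ℕ → α → E} {Y : α → E} {K : ℝ≥0} {s : Set α} (hX : ∀ n, LipschitzOnWith K (X n) s)
    (hY : ∀ t ∈ s, Tendsto (fun n => X n t) atTop (𝓝 (Y t))) : LipschitzOnWith K Y s :=
  LipschitzOnWith.of_dist_le_mul fun a ha b hb =>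
    le_of_tendsto ((hY a ha).dist (hY b hb)) (Eventually.of_forall fun n =>
      (hX n).dist_le_mul a ha b hb)

section Delayed

variable {E : Type*} [NormedAddCommGroup E]

/-- A time-dependent vector field, switched on at time `t₀`, of locally bounded linear growth and
measurable along continuous curves. -/
structure IsCaratheodoryField (F : ℝ → E → E) (t₀ : ℝ) : Prop where
  eq_zero : ∀ t ≤ t₀, ∀ x, F t x = 0
  growth : ∀ T, ∃ C, 0 ≤ C ∧ ∀ t ≤ T, ∀ x, ‖F t x‖ ≤ C * (1 + ‖x‖)
  aestronglyMeasurable : ∀ X : ℝ → E, Continuous X →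
    AEStronglyMeasurable (fun t => F t (X t)) volume

namespace IsCaratheodoryField

variable {F : ℝ → E → E} {t₀ : ℝ} (hF : IsCaratheodoryField F t₀)
include hF

theorem locallyIntegrable {X : ℝ → E} (hX : Continuous X) :
    LocallyIntegrable (fun t => F t (X t)) volume := by
  rw [locallyIntegrable_iff]
  intro k hk
  obtain ⟨T, hT⟩ := hk.bddAbove
  obtain ⟨C, hC, H⟩ := hF.growth T
  obtain ⟨M, hM⟩ := hk.exists_bound_of_continuousOn hX.continuousOn
  refine IntegrableOn.of_bound hk.measure_lt_top
    (hF.aestronglyMeasurable X hX).restrict (C * (1 + M)) ?_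
  filter_upwards [ae_restrict_mem hk.measurableSet] with t ht
  refine (H t (hT ht) _).trans ?_
  have := hM t ht
  gcongr

theorem intervalIntegrable {X : ℝ → E} (hX : Continuous X) (a b : ℝ) :
    IntervalIntegrable (fun t => F t (X t)) volume a b :=
  intervalIntegrable_iff.2 (((hF.locallyIntegrable hX).integrableOn_isCompact
    isCompact_uIcc).mono_set uIoc_subset_uIcc)

end IsCaratheodoryField

variable [NormedSpace ℝ E]

/-- Picard iterates for the delay equation `x'(t) = F(t, x(t - h))`. -/
noncomputable def delayedPicard (F : ℝ → E → E) (t₀ : ℝ) (x₀ : E) (h : ℝ) : ℕ → ℝ → E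
  | 0 => fun _ => x₀
  | k + 1 => fun t => x₀ + ∫ s in t₀..t, F s (delayedPicard F t₀ x₀ h k (s - h))

namespace IsCaratheodoryField

variable {F : ℝ → E → E} {t₀ : ℝ} (hF : IsCaratheodoryField F t₀)
include hF

theorem continuous_delayedPicard (x₀ : E) (h : ℝ) (k : ℕ) :
    Continuous (delayedPicard F t₀ x₀ h k) := by
  induction k with
  | zero => exact continuous_const
  | succ k ih =>
    exact continuous_const.add (intervalIntegral.continuous_primitive
      (fun a b => hF.intervalIntegrable (ih.comp (continuous_id.sub continuous_const)) a b) t₀)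

theorem continuous_delayedPicard_sub (x₀ : E) (h : ℝ) (k : ℕ) :
    Continuous fun s => delayedPicard F t₀ x₀ h k (s - h) :=
  (hF.continuous_delayedPicard x₀ h k).comp (continuous_id.sub continuous_const)

theorem integral_eq_zero (X : ℝ → E) {t : ℝ} (ht : t ≤ t₀) :
    ∫ s in t₀..t, F s (X s) = 0 := by
  rw [intervalIntegral.integral_congr (g := fun _ => (0 : E)), intervalIntegral.integral_zero]
  intro s hs
  rw [uIcc_of_ge ht] at hs
  exact hF.eq_zero s hs.2 _

theorem delayedPicard_of_le (x₀ : E) (h : ℝ) (k : ℕ) {t : ℝ} (ht : t ≤ t₀) :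
    delayedPicard F t₀ x₀ h k t = x₀ := by
  cases k with
  | zero => rfl
  | succ k => simp only [delayedPicard, hF.integral_eq_zero _ ht, add_zero]

/-- Method of steps: the integrand looks back by `h`, so each iteration makes the iterates agree on
a further interval of length `h`. -/
theorem delayedPicard_succ_eq (x₀ : E) (h : ℝ) (k : ℕ) :
    ∀ t ≤ t₀ + k * h, delayedPicard F t₀ x₀ h (k + 1) t = delayedPicard F t₀ x₀ h k t := by
  induction k with
  | zero =>
    intro t ht
    have ht' : t ≤ t₀ := by simpa using ht
    rw [hF.delayedPicard_of_le _ _ _ ht', hF.delayedPicard_of_le _ _ _ ht']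
  | succ k ih =>
    intro t ht
    push_cast at ht
    rcases le_total t t₀ with ht0 | ht0
    · rw [hF.delayedPicard_of_le _ _ _ ht0, hF.delayedPicard_of_le _ _ _ ht0]
    show x₀ + _ = x₀ + _
    congr 1
    refine intervalIntegral.integral_congr fun s hs => ?_
    rw [uIcc_of_le ht0] at hs
    show F s (delayedPicard F t₀ x₀ h (k + 1) (s - h)) = F s (delayedPicard F t₀ x₀ h k (s - h))
    rw [ih (s - h) (by linarith [hs.2])]

/-- Gronwall by a majorant: the exponential solves the comparison equation without delay, and being
nondecreasing it also bounds the delayed values. The bound is uniform in `h` and `k`. -/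
theorem delayedPicard_bound (x₀ : E) {T C : ℝ} (hC : 0 ≤ C)
    (H : ∀ t ≤ T, ∀ x, ‖F t x‖ ≤ C * (1 + ‖x‖)) {h : ℝ} (hh : 0 ≤ h) (k : ℕ) :
    ∀ t ≤ T, 1 + ‖delayedPicard F t₀ x₀ h k t‖ ≤ (1 + ‖x₀‖) * Real.exp (C * max (t - t₀) 0) := by
  have hA : 1 ≤ 1 + ‖x₀‖ := by linarith [norm_nonneg x₀]
  have hbase : ∀ t, 1 + ‖x₀‖ ≤ (1 + ‖x₀‖) * Real.exp (C * max (t - t₀) 0) := fun t =>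
    le_mul_of_one_le_right (by positivity) (Real.one_le_exp (by positivity))
  induction k with
  | zero => exact fun t _ => hbase t
  | succ k ih =>
    intro t ht
    rcases le_total t t₀ with ht0 | ht0
    · rw [hF.delayedPicard_of_le _ _ _ ht0]
      exact hbase t
    have hder : ∀ s ∈ uIcc t₀ t, HasDerivAt (fun s => (1 + ‖x₀‖) * Real.exp (C * (s - t₀)))
        (C * ((1 + ‖x₀‖) * Real.exp (C * (s - t₀)))) s := fun s _ => by
      have h1 : HasDerivAt (fun s => C * (s - t₀)) (C * 1) s :=
        ((hasDerivAt_id s).sub_const t₀).const_mul C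
      exact (h1.exp.const_mul (1 + ‖x₀‖)).congr_deriv (by ring)
    have hcont : Continuous fun s => C * ((1 + ‖x₀‖) * Real.exp (C * (s - t₀))) := by fun_prop
    have hint := intervalIntegral.integral_eq_sub_of_hasDerivAt hder (hcont.intervalIntegrable t₀ t)
    have hle : ‖∫ s in t₀..t, F s (delayedPicard F t₀ x₀ h k (s - h))‖ ≤
        ∫ s in t₀..t, C * ((1 + ‖x₀‖) * Real.exp (C * (s - t₀))) := by
      refine intervalIntegral.norm_integral_le_of_norm_le ht0 (Eventually.of_forall fun s hs => ?_)
        (hcont.intervalIntegrable t₀ t)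
      have hsT : s ≤ T := hs.2.trans ht
      refine (H s hsT _).trans (mul_le_mul_of_nonneg_left ((ih (s - h) (by linarith)).trans ?_) hC)
      have : max (s - h - t₀) 0 ≤ s - t₀ := max_le (by linarith) (by linarith [hs.1])
      gcongr
    rw [hint] at hle
    rw [max_eq_left (sub_nonneg.2 ht0)]
    have := norm_add_le x₀ (∫ s in t₀..t, F s (delayedPicard F t₀ x₀ h k (s - h)))
    simp only [sub_self, mul_zero, Real.exp_zero, mul_one] at hle
    simp only [delayedPicard]
    linarith

theorem exists_delayedPicard_bound (x₀ : E) (T : ℝ) :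
    ∃ M, 0 ≤ M ∧ ∀ h, 0 ≤ h → ∀ k, ∀ t ≤ T,
      ‖F t (delayedPicard F t₀ x₀ h k (t - h))‖ ≤ M := by
  obtain ⟨C, hC, H⟩ := hF.growth T
  refine ⟨C * ((1 + ‖x₀‖) * Real.exp (C * max (T - t₀) 0)), by positivity,
    fun h hh k t ht => (H t ht _).trans ?_⟩
  refine mul_le_mul_of_nonneg_left
    ((hF.delayedPicard_bound x₀ hC H hh k (t - h) (by linarith)).trans ?_) hC
  have : max (t - h - t₀) 0 ≤ max (T - t₀) 0 := max_le_max (by linarith) le_rfl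
  gcongr

theorem exists_delayedPicard_lipschitz (x₀ : E) (T : ℝ) :
    ∃ K : ℝ≥0, ∀ h, 0 ≤ h → ∀ k, LipschitzOnWith K (delayedPicard F t₀ x₀ h k) (Iic T) := by
  obtain ⟨M, hM, H⟩ := hF.exists_delayedPicard_bound x₀ T
  refine ⟨⟨M, hM⟩, fun h hh k => ?_⟩
  cases k with
  | zero => exact (LipschitzWith.const' (K := ⟨M, hM⟩) x₀).lipschitzOnWith
  | succ k =>
    refine LipschitzOnWith.of_dist_le_mul fun a ha b hb => ?_
    have hi := hF.intervalIntegrable (hF.continuous_delayedPicard_sub x₀ h k)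
    rw [dist_comm, dist_eq_norm, dist_comm, Real.dist_eq]
    simp only [delayedPicard]
    rw [add_sub_add_left_eq_sub, intervalIntegral.integral_interval_sub_left (hi t₀ b) (hi t₀ a)]
    refine intervalIntegral.norm_integral_le_of_norm_le_const fun s hs => H h hh k s ?_
    rw [uIoc, mem_Ioc] at hs
    exact hs.2.trans (max_le ha hb)

/-- Solutions of the delay equations accumulate at a locally Lipschitz curve as the delay tends to
zero. No continuity of the field is needed. -/
theorem exists_delay_limit [ProperSpace E] (x₀ : E) :
    ∃ (Z X : ℕ → ℝ → E) (Y : ℝ → E), (∀ n, Continuous (Z n)) ∧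
      (∀ n t, X n t = x₀ + ∫ s in t₀..t, F s (Z n s)) ∧
      (∀ t, Tendsto (fun n => X n t) atTop (𝓝 (Y t))) ∧
      (∀ t, Tendsto (fun n => Z n t) atTop (𝓝 (Y t))) ∧
      (∀ T, ∃ K : ℝ≥0, LipschitzOnWith K Y (Iic T)) ∧
      ∀ T, ∃ M, ∀ n, ∀ t ≤ T, ‖F t (Z n t)‖ ≤ M := by
  let h : ℕ → ℝ := fun n => 1 / ((n : ℝ) + 1)
  let P : ℕ → ℕ → ℝ → E := fun n => delayedPicard F t₀ x₀ (h n)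
  -- With delay 1/(n + 1), (n + 1)² steps give agreement of consecutive iterates up to t₀ + n + 1.
  -- Up to that time `Z n` is `X n` delayed by `h n`, so both have the same limit.
  let X : ℕ → ℝ → E := fun n => P n ((n + 1) ^ 2 + 1)
  let Z : ℕ → ℝ → E := fun n s => P n ((n + 1) ^ 2) (s - h n)
  have hh : ∀ n, 0 ≤ h n := fun n => by positivity
  have hlip : ∀ T, ∃ K : ℝ≥0, ∀ n, LipschitzOnWith K (X n) (Iic T) := fun T => by
    obtain ⟨K, hK⟩ := hF.exists_delayedPicard_lipschitz x₀ T
    exact ⟨K, fun n => hK _ (hh n) _⟩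
  obtain ⟨φ, hφ, Y, hY⟩ := exists_subseq_tendsto_of_lipschitzOnWith (t₀ := t₀) (x₀ := x₀)
    (fun n => hF.delayedPicard_of_le x₀ (h n) _ le_rfl) hlip
  refine ⟨fun n => Z (φ n), fun n => X (φ n), Y,
    fun n => hF.continuous_delayedPicard_sub x₀ _ _, fun n t => rfl, hY, fun t => ?_, fun T => ?_,
    fun T => ?_⟩
  · obtain ⟨K, hK⟩ := hlip t
    have hdist : Tendsto (fun n => dist (Z n t) (X n t)) atTop (𝓝 0) := by
      have hlim : Tendsto (fun n => (K : ℝ) * h n) atTop (𝓝 0) := by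
        simpa [h] using (tendsto_one_div_add_atTop_nhds_zero_nat (𝕜 := ℝ)).const_mul (K : ℝ)
      refine squeeze_zero' (Eventually.of_forall fun n => dist_nonneg) ?_ hlim
      filter_upwards [eventually_ge_atTop ⌈t - t₀⌉₊] with n hn
      have hn' : t - t₀ ≤ n := Nat.ceil_le.1 hn
      have hkh : (((n + 1) ^ 2 : ℕ) : ℝ) * h n = n + 1 := by
        simp only [h]; push_cast; field_simp
      have e : Z n t = X n (t - h n) :=
        (hF.delayedPicard_succ_eq x₀ (h n) _ _ (by rw [hkh]; linarith [hh n])).symm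
      rw [e]
      refine ((hK n).dist_le_mul _ (mem_Iic.2 (by linarith [hh n])) _ (mem_Iic.2 le_rfl)).trans ?_
      rw [Real.dist_eq, sub_sub_cancel_left, abs_neg, abs_of_nonneg (hh n)]
    have hd := hdist.comp hφ.tendsto_atTop
    refine tendsto_iff_dist_tendsto_zero.2 (squeeze_zero (fun n => dist_nonneg)
      (fun n => dist_triangle _ (X (φ n) t) _) ?_)
    simpa using hd.add (tendsto_iff_dist_tendsto_zero.1 (hY t))
  · obtain ⟨K, hK⟩ := hlip T
    exact ⟨K, lipschitzOnWith_of_tendsto (fun n => hK (φ n)) fun t _ => hY t⟩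
  · obtain ⟨M, _, hM⟩ := hF.exists_delayedPicard_bound x₀ T
    exact ⟨M, fun n t ht => hM _ (hh _) _ t ht⟩

/-- Passing to the limit in a linear functional of the delay equations. -/
theorem sub_eq_integral_of_tendsto {G : Type*} [NormedAddCommGroup G] [NormedSpace ℝ G]
    [CompleteSpace E] [CompleteSpace G] (L : E →L[ℝ] G) {x₀ : E} {Z X : ℕ → ℝ → E} {Y : ℝ → E}
    (hZ : ∀ n, Continuous (Z n)) (hX : ∀ n t, X n t = x₀ + ∫ s in t₀..t, F s (Z n s))
    (hXY : ∀ t, Tendsto (fun n => X n t) atTop (𝓝 (Y t)))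
    (hbound : ∀ T, ∃ M, ∀ n, ∀ t ≤ T, ‖F t (Z n t)‖ ≤ M) {a b : ℝ} {g : ℝ → G}
    (hg : ∀ s ∈ uIoc a b, Tendsto (fun n => L (F s (Z n s))) atTop (𝓝 (g s))) :
    L (Y b) - L (Y a) = ∫ s in a..b, g s := by
  have hi := fun n => hF.intervalIntegrable (hZ n)
  have e : ∀ n, L (X n b) - L (X n a) = ∫ s in a..b, L (F s (Z n s)) := fun n => by
    rw [L.intervalIntegral_comp_comm (hi n a b), ← map_sub, hX, hX, add_sub_add_left_eq_sub,
      intervalIntegral.integral_interval_sub_left (hi n t₀ b) (hi n t₀ a)]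
  have h1 : Tendsto (fun n => L (X n b) - L (X n a)) atTop (𝓝 (L (Y b) - L (Y a))) :=
    ((L.continuous.tendsto _).comp (hXY b)).sub ((L.continuous.tendsto _).comp (hXY a))
  simp only [e] at h1
  refine tendsto_nhds_unique h1 ?_
  obtain ⟨M, hM⟩ := hbound (max a b)
  refine intervalIntegral.tendsto_integral_filter_of_dominated_convergence (fun _ => ‖L‖ * M)
    (Eventually.of_forall fun n => ?_) (Eventually.of_forall fun n => Eventually.of_forall
      fun s hs => ?_) intervalIntegrable_const (Eventually.of_forall hg)
  · exact (L.continuous.comp_aestronglyMeasurable (hF.aestronglyMeasurable _ (hZ n))).restrict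
  · rw [uIoc, mem_Ioc] at hs
    exact (L.le_opNorm _).trans (by gcongr; exact hM n s hs.2)

end IsCaratheodoryField

end Delayed

/-! ### Existence and continuation of Filippov solutions. -/

theorem Real.measurable_sign : Measurable Real.sign :=
  Measurable.ite measurableSet_Iio measurable_const
    (Measurable.ite measurableSet_Ioi measurable_const measurable_const)

theorem Real.continuousAt_sign {r : ℝ} (hr : r ≠ 0) : ContinuousAt Real.sign r := by
  rcases lt_or_gt_of_ne hr with h | h
  · exact continuousAt_const.congr
      ((eventually_lt_nhds h).mono fun x hx => (Real.sign_of_neg hx).symm)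
  · exact continuousAt_const.congr
      ((eventually_gt_nhds h).mono fun x hx => (Real.sign_of_pos hx).symm)

theorem hasDerivAt_of_sub_eq_mul {f : ℝ → ℝ} {c t : ℝ}
    (h : ∀ᶠ u in 𝓝 t, f u - f t = c * (u - t)) : HasDerivAt f c t := by
  have h1 : HasDerivAt (fun u => f t + c * (u - t)) (c * 1) t :=
    ((((hasDerivAt_id t).sub_const t).const_mul c).const_add (f t))
  rw [mul_one] at h1
  exact h1.congr_of_eventuallyEq (h.mono fun u hu => by simp only; linarith)

namespace OnlineTask

variable {n p m : ℕ} {S : OnlineTask n p m} {D : ℝ}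

namespace Admissible

theorem aestronglyMeasurable_updateField (h : S.Admissible D) (k₁ k₂ : ℝ) {t₀ : ℝ} (ht₀ : 0 ≤ t₀)
    {X : ℝ → LastLayerState p m} (hX : Continuous X) :
    AEStronglyMeasurable (fun t => S.updateField k₁ k₂ t (X t)) (volume.restrict (Ioi t₀)) := by
  have hsub : Ioi t₀ ⊆ Ici 0 := fun t ht => ht₀.trans (le_of_lt ht)
  have hf (j : Fin p) : AEMeasurable (fun t => S.feature t j) (volume.restrict (Ioi t₀)) :=
    ((h.continuousOn_feature_apply j).mono hsub).aemeasurable measurableSet_Ioi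
  have hy (i : Fin m) : AEMeasurable (fun t => S.target t i) (volume.restrict (Ioi t₀)) :=
    (((continuous_apply i).comp_continuousOn h.contDiffOn_target.continuousOn).mono
      hsub).aemeasurable measurableSet_Ioi
  have hW (i : Fin m) (j : Fin p) : AEMeasurable (fun t => (X t).2.1 i j)
      (volume.restrict (Ioi t₀)) :=
    Continuous.aemeasurable (by fun_prop)
  have hb (i : Fin m) : AEMeasurable (fun t => (X t).1 i) (volume.restrict (Ioi t₀)) :=
    Continuous.aemeasurable (by fun_prop)
  have hz (i : Fin m) : AEMeasurable (fun t => (X t).2.2 i) (volume.restrict (Ioi t₀)) :=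
    Continuous.aemeasurable (by fun_prop)
  have he (i : Fin m) : AEMeasurable (fun t => S.e₁ t (X t) i) (volume.restrict (Ioi t₀)) := by
    unfold e₁ output
    exact ((Finset.aemeasurable_fun_sum _ fun j _ => (hW i j).mul (hf j)).add (hb i)).sub (hy i)
  have hs (i : Fin m) : AEMeasurable (fun t => Real.sign (S.e₁ t (X t) i))
      (volume.restrict (Ioi t₀)) :=
    Real.measurable_sign.comp_aemeasurable (he i)
  have hbias (i : Fin m) : AEMeasurable (fun t => S.biasLaw k₁ t (X t) i)
      (volume.restrict (Ioi t₀)) := by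
    unfold biasLaw Gamma
    exact (((((he i).norm.sqrt.const_mul (-k₁)).mul (hs i)).sub
      (Finset.aemeasurable_fun_sum _ fun j _ => (hW i j).mul (measurable_deriv _).aemeasurable)).add
      (hz i)).const_mul _
  have hw (i : Fin m) (j : Fin p) :
      AEMeasurable (fun t => S.weightLaw k₁ t (X t) i j) (volume.restrict (Ioi t₀)) :=
    (hbias i).mul ((hf j).div (Finset.aemeasurable_fun_sum _ fun l _ => (hf l).pow_const 2))
  have h1 := (aemeasurable_pi_iff.2 hbias).aestronglyMeasurable
  have h2 := (aemeasurable_pi_iff.2 fun i => aemeasurable_pi_iff.2 (hw i)).aestronglyMeasurable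
  have h3 := (aemeasurable_pi_iff.2 fun i => (hs i).const_mul (-k₂)).aestronglyMeasurable
  exact h1.prodMk (h2.prodMk h3)

theorem isCaratheodoryField_updateField (h : S.Admissible D) (k₁ : ℝ) {k₂ : ℝ} (hk₂ : 0 ≤ k₂)
    {t₀ : ℝ} (ht₀ : 0 ≤ t₀) :
    IsCaratheodoryField
      (fun t X => (Ioi t₀).indicator (fun t => S.updateField k₁ k₂ t X) t) t₀ where
  eq_zero t ht X := indicator_of_notMem (by simpa using ht) _
  growth T := by
    obtain ⟨C, hC, H⟩ := h.exists_velocity_growth k₁ k₂ T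
    refine ⟨C, hC, fun t ht X => ?_⟩
    by_cases hmem : t ∈ Ioi t₀
    · rw [indicator_of_mem hmem]
      exact H t ⟨ht₀.trans_lt hmem, ht⟩ X _ (S.isUpdateVelocity_updateField k₁ hk₂ X)
    · rw [indicator_of_notMem hmem, norm_zero]
      positivity
  aestronglyMeasurable X hX := by
    have e : (fun t => (Ioi t₀).indicator (fun t' => S.updateField k₁ k₂ t' (X t)) t) =
        (Ioi t₀).indicator fun t => S.updateField k₁ k₂ t (X t) := by
      funext t
      by_cases hmem : t ∈ Ioi t₀ <;> simp [indicator, hmem]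
    rw [e, aestronglyMeasurable_indicator_iff measurableSet_Ioi]
    exact h.aestronglyMeasurable_updateField k₁ k₂ ht₀ hX

theorem continuousOn_e₁_comp (h : S.Admissible D) {Y : ℝ → LastLayerState p m} (hY : Continuous Y)
    (i : Fin m) : ContinuousOn (fun t => S.e₁ t (Y t) i) (Ici 0) := by
  unfold e₁ output
  have hy : ContinuousOn (fun t => S.target t i) (Ici 0) :=
    (continuous_apply i).comp_continuousOn h.contDiffOn_target.continuousOn
  refine ((continuousOn_finsetSum _ fun j _ => ?_).add ?_).sub hy
  · exact ContinuousOn.mul (Continuous.continuousOn (by fun_prop)) (h.continuousOn_feature_apply j)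
  · exact Continuous.continuousOn (by fun_prop)

/-- Existence for the closed loop started at time `t₀`. -/
theorem exists_solution_from (h : S.Admissible D) (k₁ : ℝ) {k₂ : ℝ} (hk₂ : 0 ≤ k₂) {t₀ : ℝ}
    (ht₀ : 0 ≤ t₀) (X₀ : LastLayerState p m) :
    ∃ Y : ℝ → LastLayerState p m, Y t₀ = X₀ ∧ (∀ t ≤ t₀, Y t = X₀) ∧
      (∀ T, ∃ K : ℝ≥0, LipschitzOnWith K Y (Iic T)) ∧
      ∀ᵐ t : ℝ, t₀ < t → ∃ v, S.IsUpdateVelocity k₁ k₂ t (Y t) v ∧ HasDerivAt Y v t := by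
  set F : ℝ → LastLayerState p m → LastLayerState p m :=
    fun t X => (Ioi t₀).indicator (fun t => S.updateField k₁ k₂ t X) t with hFdef
  have hF : IsCaratheodoryField F t₀ := h.isCaratheodoryField_updateField k₁ hk₂ ht₀
  have hFgt : ∀ {t}, t₀ < t → ∀ X, F t X = S.updateField k₁ k₂ t X := fun ht X =>
    indicator_of_mem (mem_Ioi.2 ht) _
  obtain ⟨Z, X, Y, hZ, hX, hXY, hZY, hlip, hbound⟩ := hF.exists_delay_limit X₀
  have hY : Continuous Y := continuous_iff_continuousAt.2 fun t => by
    obtain ⟨K, hK⟩ := hlip (t + 1)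
    exact hK.continuousOn.continuousAt (Iic_mem_nhds (lt_add_one t))
  have hYle : ∀ t ≤ t₀, Y t = X₀ := fun t ht => by
    refine tendsto_nhds_unique (hXY t) ?_
    simp only [hX, hF.integral_eq_zero _ ht, add_zero]
    exact tendsto_const_nhds
  refine ⟨Y, hYle t₀ le_rfl, hYle, hlip, ?_⟩
  -- The (b, W) part, on which the field is continuous in the state and the integral equation passes
  -- to the limit. The discontinuous rates are treated one component at a time.
  let L : LastLayerState p m →L[ℝ] (Fin m → ℝ) × (Fin m → Fin p → ℝ) :=
    (ContinuousLinearMap.fst ℝ _ _).prod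
      ((ContinuousLinearMap.fst ℝ _ _).comp (ContinuousLinearMap.snd ℝ _ _))
  let rate (i : Fin m) : LastLayerState p m →L[ℝ] ℝ :=
    (ContinuousLinearMap.proj (R := ℝ) (φ := fun _ : Fin m => ℝ) i).comp
      ((ContinuousLinearMap.snd ℝ (Fin m → Fin p → ℝ) (Fin m → ℝ)).comp
        (ContinuousLinearMap.snd ℝ (Fin m → ℝ) ((Fin m → Fin p → ℝ) × (Fin m → ℝ))))
  have hLcont : ∀ t, Continuous fun X => L (F t X) := fun t => by
    by_cases ht : t₀ < t
    · simp only [hFgt ht]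
      exact (S.continuous_biasLaw k₁ t).prodMk (S.continuous_weightLaw k₁ t)
    · simp only [hF.eq_zero t (not_lt.1 ht), map_zero]
      exact continuous_const
  have hLint : ∀ t, L (Y t) = L X₀ + ∫ s in t₀..t, L (F s (Y s)) := fun t => by
    rw [← hF.sub_eq_integral_of_tendsto L hZ hX hXY hbound (a := t₀) (b := t)
      (fun s _ => ((hLcont s).tendsto _).comp (hZY s)), hYle t₀ le_rfl, add_sub_cancel]
  have hLloc : LocallyIntegrable (fun s => L (F s (Y s))) volume := by
    rw [locallyIntegrable_iff]
    exact fun k hk => L.integrable_comp ((hF.locallyIntegrable hY).integrableOn_isCompact hk)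
  have hrate_lip : ∀ i, LipschitzOnWith ⟨k₂, hk₂⟩ (fun t => rate i (Y t)) univ := fun i => by
    refine lipschitzOnWith_of_tendsto (X := fun n t => rate i (X n t)) (fun n => ?_)
      fun t _ => ((rate i).continuous.tendsto _).comp (hXY t)
    refine LipschitzOnWith.of_dist_le_mul fun a _ b _ => ?_
    have hi := hF.intervalIntegrable (hZ n)
    rw [dist_comm, dist_eq_norm, dist_comm, Real.dist_eq, ← map_sub, hX, hX,
      add_sub_add_left_eq_sub,
      intervalIntegral.integral_interval_sub_left (hi t₀ b) (hi t₀ a),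
      ← (rate i).intervalIntegral_comp_comm (hi a b)]
    refine intervalIntegral.norm_integral_le_of_norm_le_const fun s _ => ?_
    by_cases hs : t₀ < s
    · rw [hFgt hs]
      exact (S.isUpdateVelocity_updateField k₁ hk₂ _).rate_le i
    · rw [hF.eq_zero s (not_lt.1 hs), map_zero, norm_zero]
      exact hk₂
  have hrate_diff : ∀ i, ∀ᵐ t : ℝ, DifferentiableAt ℝ (fun t => rate i (Y t)) t := fun i =>
    (lipschitzOnWith_univ.1 (hrate_lip i)).ae_differentiableAt
  -- Near such a time the sign along the limit is constant, and the signs along the approximations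
  -- converge to it, so this component of ẑ₂ is locally affine. Where the error vanishes, the bound
  -- k₂ suffices.
  have hrate_const : ∀ i t, t₀ < t → S.e₁ t (Y t) i ≠ 0 →
      HasDerivAt (fun t => rate i (Y t)) (-k₂ * Real.sign (S.e₁ t (Y t) i)) t := by
    intro i t ht hne
    have hc : ContinuousAt (fun t => S.e₁ t (Y t) i) t :=
      (h.continuousOn_e₁_comp hY i).continuousAt (Ici_mem_nhds (ht₀.trans_lt ht))
    have hev : ∀ᶠ s in 𝓝 t, t₀ < s ∧ S.e₁ s (Y s) i ≠ 0 ∧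
        Real.sign (S.e₁ s (Y s) i) = Real.sign (S.e₁ t (Y t) i) := by
      refine (lt_mem_nhds ht).and ((hc.eventually_ne hne).and ?_)
      rcases lt_or_gt_of_ne hne with hlt | hgt
      · filter_upwards [hc.eventually (gt_mem_nhds hlt)] with s hs
        rw [Real.sign_of_neg hs, Real.sign_of_neg hlt]
      · filter_upwards [hc.eventually (lt_mem_nhds hgt)] with s hs
        rw [Real.sign_of_pos hs, Real.sign_of_pos hgt]
    obtain ⟨δ, hδ, hball⟩ := Metric.eventually_nhds_iff_ball.1 hev
    refine hasDerivAt_of_sub_eq_mul ?_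
    filter_upwards [Metric.ball_mem_nhds t hδ] with u hu
    rw [hF.sub_eq_integral_of_tendsto (rate i) hZ hX hXY hbound (a := t) (b := u)
      (g := fun _ => -k₂ * Real.sign (S.e₁ t (Y t) i)) fun s hs => ?_,
      intervalIntegral.integral_const, smul_eq_mul, mul_comm]
    have hsball : s ∈ Metric.ball t δ := by
      rw [Real.ball_eq_Ioo] at hu ⊢
      have ht' : t ∈ Ioo (t - δ) (t + δ) := ⟨by linarith, by linarith⟩
      exact ordConnected_Ioo.uIcc_subset ht' hu (uIoc_subset_uIcc hs)
    obtain ⟨h1, h2, h3⟩ := hball s hsball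
    simp only [hFgt h1]
    have hsgn := (Real.continuousAt_sign h2).tendsto.comp
      (((S.continuous_e₁ s i).tendsto _).comp (hZY s))
    rw [← h3]
    exact hsgn.const_mul (-k₂)
  filter_upwards [LocallyIntegrable.ae_hasDerivAt_integral hLloc, ae_all_iff.2 hrate_diff]
    with t hLt hrt ht
  have hderL : HasDerivAt (fun t => L (Y t)) (L (F t (Y t))) t := by
    rw [funext hLint]
    exact (hLt t₀).const_add _
  have hder1 : HasDerivAt (fun t => (Y t).1) (S.biasLaw k₁ t (Y t)) t := by
    have := hasFDerivAt_fst.comp_hasDerivAt t hderL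
    rwa [hFgt ht] at this
  have hder2 : HasDerivAt (fun t => (Y t).2.1) (S.weightLaw k₁ t (Y t)) t := by
    have := hasFDerivAt_snd.comp_hasDerivAt t hderL
    rwa [hFgt ht] at this
  have hder3 : HasDerivAt (fun t => (Y t).2.2) (fun i => deriv (fun t => rate i (Y t)) t) t :=
    hasDerivAt_pi.2 fun i => (hrt i).hasDerivAt
  refine ⟨(S.biasLaw k₁ t (Y t), S.weightLaw k₁ t (Y t), fun i => deriv (fun t => rate i (Y t)) t),
    ⟨rfl, rfl, fun i hi => ?_, fun i hi => ?_, fun i => ?_⟩, hder1.prodMk (hder2.prodMk hder3)⟩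
  · show deriv (fun t => rate i (Y t)) t = -k₂
    rw [(hrate_const i t ht hi.ne').deriv, Real.sign_of_pos hi, mul_one]
  · show deriv (fun t => rate i (Y t)) t = k₂
    rw [(hrate_const i t ht hi.ne).deriv, Real.sign_of_neg hi, mul_neg_one, neg_neg]
  · exact (hrate_lip i).norm_deriv_le univ_mem

theorem exists_solution (h : S.Admissible D) (k₁ : ℝ) {k₂ : ℝ} (hk₂ : 0 ≤ k₂)
    (X₀ : LastLayerState p m) : ∃ X, X 0 = X₀ ∧ S.FollowsUpdateLaws k₁ k₂ (Ici 0) X := by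
  obtain ⟨Y, hY0, -, hlip, hder⟩ := h.exists_solution_from k₁ hk₂ le_rfl X₀
  refine ⟨Y, hY0, fun T hT => ?_, ?_⟩
  · obtain ⟨K, hK⟩ := hlip T
    refine (hK.mono ?_).absolutelyContinuousOnInterval
    rw [uIcc_of_le hT]
    exact Icc_subset_Iic_self
  · filter_upwards [hder, Measure.ae_ne volume (0 : ℝ)] with t ht hne hmem
    obtain ⟨v, hv, hd⟩ := ht (lt_of_le_of_ne hmem hne.symm)
    exact ⟨v, hv.mem_filippovMap, hd⟩

theorem exists_extension (h : S.Admissible D) (k₁ : ℝ) {k₂ : ℝ} (hk₂ : 0 ≤ k₂) {τ : ℝ} (hτ : 0 < τ)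
    {X : ℝ → LastLayerState p m} (hX : S.FollowsUpdateLaws k₁ k₂ (Ico 0 τ) X) :
    ∃ X', S.FollowsUpdateLaws k₁ k₂ (Ici 0) X' ∧ EqOn X' X (Ico 0 τ) := by
  obtain ⟨K, hK⟩ := h.exists_lipschitzOnWith_solution hk₂ hτ hX
  obtain ⟨g, hg, hgX⟩ := hK.extend_finite_dimension
  obtain ⟨Y, -, hYle, hlip, hder⟩ := h.exists_solution_from k₁ hk₂ hτ.le (g τ)
  -- `Y` equals `g τ` up to `τ`, so this sum is `g` before `τ` and `Y` after it. Written as a sum,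
  -- it is absolutely continuous without a gluing argument.
  let X' : ℝ → LastLayerState p m := fun t => g (min t τ) + (Y t - g τ)
  have hlt : ∀ t ≤ τ, X' t = g t := fun t ht => by
    simp [X', hYle t ht, min_eq_left ht]
  have hgt : ∀ t, τ ≤ t → X' t = Y t := fun t ht => by simp [X', min_eq_right ht]
  have heq : EqOn X' X (Ico 0 τ) := fun t ht => (hlt t ht.2.le).trans (hgX ht).symm
  refine ⟨X', ⟨fun T hT => ?_, ?_⟩, heq⟩
  · obtain ⟨K', hK'⟩ := hlip T
    have h1 : AbsolutelyContinuousOnInterval (fun t => g (min t τ)) 0 T :=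
      ((hg.comp (LipschitzWith.id.min_const τ)).lipschitzOnWith).absolutelyContinuousOnInterval
    have h2 : AbsolutelyContinuousOnInterval Y 0 T := (hK'.mono (by
      rw [uIcc_of_le hT]
      exact Icc_subset_Iic_self)).absolutelyContinuousOnInterval
    have h3 : AbsolutelyContinuousOnInterval (fun _ : ℝ => g τ) 0 T :=
      (LipschitzWith.const (g τ)).lipschitzOnWith.absolutelyContinuousOnInterval
    exact h1.add (h2.sub h3)
  · filter_upwards [hX.2, hder, Measure.ae_ne volume (0 : ℝ), Measure.ae_ne volume τ]
      with t ht1 ht2 h0 hne hmem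
    have hpos : 0 < t := lt_of_le_of_ne hmem h0.symm
    rcases lt_or_gt_of_ne hne with hlτ | hgτ
    · obtain ⟨v, hv, hd⟩ := ht1 ⟨hmem, hlτ⟩
      rw [heq ⟨hmem, hlτ⟩]
      refine ⟨v, hv, hd.congr_of_eventuallyEq ?_⟩
      filter_upwards [Ioo_mem_nhds hpos hlτ] with s hs using heq (Ioo_subset_Ico_self hs)
    · obtain ⟨v, hv, hd⟩ := ht2 hgτ
      rw [hgt t hgτ.le]
      refine ⟨v, hv.mem_filippovMap, hd.congr_of_eventuallyEq ?_⟩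
      filter_upwards [Ioi_mem_nhds hgτ] with s hs using hgt s (le_of_lt hs)

end Admissible

end OnlineTask

theorem forwardComplete_of_nonneg (D k₁ : ℝ) {k₂ : ℝ} (hk₂ : 0 ≤ k₂) : ForwardComplete D k₁ k₂ :=
  fun _ _ _ _ h => ⟨h.exists_solution k₁ hk₂, fun _ _ hτ hX => h.exists_extension k₁ hk₂ hτ hX⟩

theorem theorem1 (D : ℝ) (hD : 0 < D) :
    ∃ k₁ k₂ : ℝ, 0 < k₁ ∧ 0 < k₂ ∧
      ForwardComplete D k₁ k₂ ∧ ErrorEquilibrium D k₁ k₂ ∧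
      RobustlyStable D k₁ k₂ ∧ RobustlyFiniteTimeConvergent D k₁ k₂ := by
  obtain ⟨d, hd, rfl⟩ : ∃ d, 0 < d ∧ D = d ^ 2 :=
    ⟨√D, Real.sqrt_pos.2 hD, (Real.sq_sqrt hD.le).symm⟩
  exact ⟨4 * d, 2 * d ^ 2, by positivity, by positivity,
    forwardComplete_of_nonneg _ _ (by positivity), errorEquilibrium_of_sq hd,
    robustlyStable_of_sq hd, robustlyFiniteTimeConvergent_of_sq hd⟩
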